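/- Notation. $\|\cdot\|_2$ is the spectral norm, $\kappa(F)=\|F\|_2\|F^{-1}\|_2$, $\lambda_{\min}$ is the smallest eigenvalue of a symmetric matrix, and $\sigma_1(M)\ge\sigma_2(M)\ge\dots$ are the singular values of $M$, continued by zeros. For a matrix $M\in\mathbb R^{m\times m}$ that is diagonalizable over $\mathbb C$, $\kappa_{\mathrm{eig}}(M)=\inf\|V\|_2\|V^{-1}\|_2$ over all invertible $V\in\mathbb C^{m\times m}$ with $V^{-1}MV$ diagonal. For $M\in\mathbb R^{n\times n}$, $\mathrm{Off}(M)$ is the set of the blocks $M(s+1:n,\,1:s)$ and $M(1:s,\,s+1:n)$, $s=1,\dots,n-1$, and the quasiseparable order of $M$ is the largest rank of a block in $\mathrm{Off}(M)$ ($0$ if $n=1$). For $E,G\subset\mathbb C$, $$Z_h(E,G)=\inf_{g}\ \frac{\sup_{z\in E}|g(z)|}{\inf_{z\in G}|g(z)|},$$ where $g$ ranges over the rational functions with numerator and denominator of degree at most $h$, without poles in $E$ and without zeros in $G$ ($|g|=\infty$ at poles). Statement. Let $n\ge 1$ and let $A,F,Q\in\mathbb R^{n\times n}$ have quasiseparable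 orders $r_a,r_f,r_q$. Assume that the numerical range $\{x^HAx: x\in\mathbb C^n,\ \|x\|_2=1\}$ of $A$ lies in $\{\Re z<0\}$ and that $F$ and $Q$ are symmetric positive definite. Let $X$ be the symmetric positive semidefinite stabilizing solution of $$A^\top X+XA-XFX+Q=0,$$ stabilizing meaning that all eigenvalues of $A-FX$ have non-positive real part. For $j=1,\dots,n$ let $A^{(j)},F^{(j)},Q^{(j)}$ and $A_{(j)},F_{(j)},Q_{(j)}$ be the principal submatrices of $A,F,Q$ for the first, respectively the last, $j$ indices, let $X^{(j)},X_{(j)}$ be the symmetric positive semidefinite stabilizing solutions of the Riccati equations with these coefficients, and let $C^{(j)}=A^{(j)}-F^{(j)}X^{(j)}$, $C_{(j)}=A_{(j)}-F_{(j)}X_{(j)}$ be the closed-loop matrices. Assume that all $C^{(j)}$ and $C_{(j)}$ are diagonalizable over $\mathbb C$, and put $t=4r_a+2r_f+2r_q$, $$\mathfrak K=\kappa_{\mathrm{eig}}(A-FX)\cdot\max\Big\{\max_{1\le j\le n}\kappa_{\mathrm{eig}}(C^{(j)}),\ \max_{1\le j\le n}\kappa_{\mathrm{eig}}(C_{(j)})\Big\},$$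 $$r_\ell=\sqrt{\frac{\lambda_{\min}(Q)}{3\|F^{-1}\|_2}},\qquad r_u=\|A\|_2\sqrt{\kappa(F)}+\sqrt{2\|A\|_2^2\,\kappa(F)+\|Q\|_2\|F\|_2}.$$ Then there exists $\tau>0$, namely the number for which $-\tau$ is the largest real part of an eigenvalue of the matrices $C^{(j)},C_{(j)}$ $(1\le j\le n)$, such that the set $$E=\{z\in\mathbb C:\ \Re z\le-\tau,\ r_\ell\le|z|\le r_u\}$$ contains all eigenvalues of all $C^{(j)}$ and $C_{(j)}$, and every $M\in\mathrm{Off}(X)$ satisfies $$\frac{\sigma_{ht+1}(M)}{\|X\|_2}\le\mathfrak K\cdot Z_h(E,-E),\qquad h=1,2,\dots$$ Additionally, if $L$ is the Cholesky factor of $F$ (lower triangular with positive diagonal, $LL^\top=F$) and $$\frac{\|L^\top AL^{-\top}-L^{-1}A^\top L\|_2^2}{4}<\frac{\lambda_{\min}(Q)}{\|F^{-1}\|_2},$$ then $$\tau\ \ge\ \sqrt{\frac{\lambda_{\min}(Q)}{\|F^{-1}\|_2}-\frac{\|L^\top AL^{-\top}-L^{-1}A^\top L\|_2^2}{4}}\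 >\ 0.$$ -/

import Mathlib

/-! Matrix norms below are spectral norms (operator 2-norms). -/

open scoped Matrix Matrix.Norms.L2Operator Pointwise ENNReal

noncomputable section

namespace Riccati

/-- A real matrix regarded as a complex matrix. -/
def complexify {p q : ℕ} (M : Matrix (Fin p) (Fin q) ℝ) : Matrix (Fin p) (Fin q) ℂ :=
  M.map Complex.ofReal

/-- The numerical range `{xᴴ A x : x ∈ ℂⁿ, ‖x‖₂ = 1}`. -/
def numRange {n : ℕ} (A : Matrix (Fin n) (Fin n) ℝ) : Set ℂ :=
  {z | ∃ x : EuclideanSpace ℂ (Fin n), ‖x‖ = 1 ∧ z = star x.ofLp ⬝ᵥ (complexify A *ᵥ x.ofLp)}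

/-- The set of complex eigenvalues of a real square matrix. -/
def eigs {n : ℕ} (M : Matrix (Fin n) (Fin n) ℝ) : Set ℂ := spectrum ℂ (complexify M)

/-- The smallest eigenvalue of a real symmetric matrix. -/
def lambdaMin {n : ℕ} (M : Matrix (Fin n) (Fin n) ℝ) : ℝ := sInf (spectrum ℝ M)

/-- The 2-norm condition number of an invertible matrix. -/
def cond2 {n : ℕ} (M : Matrix (Fin n) (Fin n) ℝ) : ℝ := ‖M‖ * ‖M⁻¹‖

/-- The complex matrix `V` is an eigenvector matrix of `M`: it is invertible and
`M V = V D` with `D` diagonal. -/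
def IsEigenvectorMatrix {n : ℕ} (M : Matrix (Fin n) (Fin n) ℝ) (V : Matrix (Fin n) (Fin n) ℂ) :
    Prop :=
  IsUnit V ∧ ∃ d : Fin n → ℂ, complexify M * V = V * Matrix.diagonal d

/-- `M` is diagonalizable over `ℂ`. -/
def IsDiagonalizable {n : ℕ} (M : Matrix (Fin n) (Fin n) ℝ) : Prop :=
  ∃ V, IsEigenvectorMatrix M V

/-- The eigenvector condition number of a diagonalizable matrix, for the best choice of the
eigenvector matrix. -/
def kappaEig {n : ℕ} (M : Matrix (Fin n) (Fin n) ℝ) : ℝ :=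
  sInf ((fun V : Matrix (Fin n) (Fin n) ℂ => ‖V‖ * ‖V⁻¹‖) '' {V | IsEigenvectorMatrix M V})

/-- The singular values `σ₁ ≥ σ₂ ≥ …` of a matrix, numbered from `1` and continued by zeros
(Mathlib numbers them from `0`). -/
def sigma {p q : ℕ} (M : Matrix (Fin p) (Fin q) ℝ) (i : ℕ) : ℝ :=
  (Matrix.toEuclideanLin M).singularValues (i - 1)

/-- The first `j` of `n` indices. -/
def firstIdx {j n : ℕ} (hj : j ≤ n) : Fin j → Fin n := Fin.castLE hj

/-- The last `j` of `n` indices. -/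
def lastIdx {j n : ℕ} (hj : j ≤ n) : Fin j → Fin n := fun i => ⟨n - j + i, by omega⟩

/-- The leading principal submatrix `M^{(j)}` of order `j`. -/
def leading {n j : ℕ} (M : Matrix (Fin n) (Fin n) ℝ) (hj : j ≤ n) : Matrix (Fin j) (Fin j) ℝ :=
  M.submatrix (firstIdx hj) (firstIdx hj)

/-- The trailing principal submatrix `M_{(j)}` of order `j`. -/
def trailing {n j : ℕ} (M : Matrix (Fin n) (Fin n) ℝ) (hj : j ≤ n) : Matrix (Fin j) (Fin j) ℝ :=
  M.submatrix (lastIdx hj) (lastIdx hj)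

/-- The set `Off(M)` of the maximal off-diagonal blocks `M(s+1:n, 1:s)` and `M(1:s, s+1:n)`,
`s = 1, …, n-1`, each together with its numbers of rows and columns. -/
def Off {n : ℕ} (M : Matrix (Fin n) (Fin n) ℝ) :
    Set ((p : ℕ) × (q : ℕ) × Matrix (Fin p) (Fin q) ℝ) :=
  {B | ∃ (s : ℕ) (_ : 1 ≤ s) (hs : s < n),
    B = ⟨n - s, s, M.submatrix (lastIdx (Nat.sub_le n s)) (firstIdx hs.le)⟩ ∨
    B = ⟨s, n - s, M.submatrix (firstIdx hs.le) (lastIdx (Nat.sub_le n s))⟩}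

/-- The quasiseparable order: the largest rank of a block in `Off(M)` (`0` if there is none). -/
def qsrank {n : ℕ} (M : Matrix (Fin n) (Fin n) ℝ) : ℕ :=
  sSup ((fun B => B.2.2.rank) '' Off M)

/-- The closed-loop matrix `A - F X`. -/
def closedLoop {n : ℕ} (A F X : Matrix (Fin n) (Fin n) ℝ) : Matrix (Fin n) (Fin n) ℝ := A - F * X

/-- `X` is a symmetric positive semidefinite stabilizing solution of
`Aᵀ X + X A - X F X + Q = 0`. -/
structure IsStabilizingSolution {n : ℕ} (A F Q X : Matrix (Fin n) (Fin n) ℝ) : Prop where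
  posSemidef : X.PosSemidef
  care : Aᵀ * X + X * A - X * F * X + Q = 0
  stable : ∀ z ∈ eigs (closedLoop A F X), z.re ≤ 0

/-- `L` is the Cholesky factor of `F`: lower triangular with positive diagonal, `L Lᵀ = F`. -/
structure IsCholeskyFactor {n : ℕ} (L F : Matrix (Fin n) (Fin n) ℝ) : Prop where
  lower : ∀ i j, i < j → L i j = 0
  diag_pos : ∀ i, 0 < L i i
  mul_transpose : L * Lᵀ = F

/-- The modulus `|g(z)| ∈ [0, ∞]` of a rational function, `∞` at its poles (numerator and
denominator are coprime, so `0 / 0` does not occur). -/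
def ratAbs (g : RatFunc ℂ) (z : ℂ) : ℝ≥0∞ := ‖g.num.eval z‖ₑ / ‖g.denom.eval z‖ₑ

/-- The rational functions with numerator and denominator of degree at most `h`. -/
def ratDeg (h : ℕ) : Set (RatFunc ℂ) := {g | g.num.natDegree ≤ h ∧ g.denom.natDegree ≤ h}

/-- The Zolotarev number: the infimum of `max_E |g| / min_F |g|` over the rational functions `g`
of type `(h, h)` without poles in `E` and without zeros in `F` (the others do not give a finite
quotient). -/
def zolotarev (h : ℕ) (E F : Set ℂ) : ℝ≥0∞ :=
  ⨅ g ∈ {g ∈ ratDeg h | (∀ z ∈ E, g.denom.eval z ≠ 0) ∧ (∀ z ∈ F, g.num.eval z ≠ 0)},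
    (⨆ z ∈ E, ratAbs g z) / (⨅ z ∈ F, ratAbs g z)

/-- The part of the annulus `rl ≤ |z| ≤ ru` in the half plane `Re z ≤ -τ`. -/
def annulusPart (τ rl ru : ℝ) : Set ℂ := {z | z.re ≤ -τ ∧ rl ≤ ‖z‖ ∧ ‖z‖ ≤ ru}

/-- The inner radius `√(λ_min(Q) / (3 ‖F⁻¹‖₂))`. -/
def rLower {n : ℕ} (F Q : Matrix (Fin n) (Fin n) ℝ) : ℝ := √(lambdaMin Q / (3 * ‖F⁻¹‖))

/-- The outer radius `‖A‖₂ √κ(F) + √(2 ‖A‖₂² κ(F) + ‖Q‖₂ ‖F‖₂)`. -/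
def rUpper {n : ℕ} (A F Q : Matrix (Fin n) (Fin n) ℝ) : ℝ :=
  ‖A‖ * √(cond2 F) + √(2 * ‖A‖ ^ 2 * cond2 F + ‖Q‖ * ‖F‖)

/-- The constant `κ_eig(A - F X) · max {max_j κ_eig(C^{(j)}), max_j κ_eig(C_{(j)})}`, where
`C^{(j)}` and `C_{(j)}`, `1 ≤ j ≤ n`, are the closed-loop matrices of the leading and trailing
principal subproblems with solutions `Xl j` and `Xt j`. -/
def kappaConst {n : ℕ} (A F X : Matrix (Fin n) (Fin n) ℝ)
    (Xl Xt : ∀ j : ℕ, Matrix (Fin j) (Fin j) ℝ) : ℝ :=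
  kappaEig (closedLoop A F X) *
    max (⨆ j : Set.Icc 1 n, kappaEig (closedLoop (leading A j.2.2) (leading F j.2.2) (Xl j)))
      (⨆ j : Set.Icc 1 n, kappaEig (closedLoop (trailing A j.2.2) (trailing F j.2.2) (Xt j)))

/-- All the eigenvalues of the closed-loop matrices `C^{(j)}` and `C_{(j)}`, `1 ≤ j ≤ n`. -/
def subproblemEigs {n : ℕ} (A F : Matrix (Fin n) (Fin n) ℝ)
    (Xl Xt : ∀ j : ℕ, Matrix (Fin j) (Fin j) ℝ) : Set ℂ :=
  (⋃ j : Set.Icc 1 n, eigs (closedLoop (leading A j.2.2) (leading F j.2.2) (Xl j))) ∪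
    (⋃ j : Set.Icc 1 n, eigs (closedLoop (trailing A j.2.2) (trailing F j.2.2) (Xt j)))

end Riccati

end

open Riccati

open Riccati

/-! The solution is approximated by running a shifted iteration on the Riccati equation from a
scalar matrix, and counting how fast the rank of the off-diagonal blocks can grow. Let C = A - FX,
let H = [A, -F; -Q, -Aᴴ] be the Hamiltonian matrix, and write an iterate as P = X + E with E ≥ 0.
For a shift p in the right half plane the next iterate P' is the one for which (H - p)w lies in the
graph of P' whenever (H + p̄)w lies in the graph of P (`shift_graph`).

Error: the new error lies between 0 and TᴴET, where T = (C - p)⁻¹(C + p̄) (`shiftError_le`). With an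
eigenvector matrix V of C, a product of such T has norm at most ‖V‖‖V⁻¹‖β, where β bounds the
Blaschke product ∏ |d + p̄|/|d - p| over the eigenvalues d of C. Starting at P = ‖X‖·1, where the
error is at most ‖X‖·1, the final error is at most ‖X‖(‖V‖‖V⁻¹‖β)².

Rank: one shift raises the rank of an off-diagonal block of P by at most the sum of the ranks of the
corresponding blocks of A, Aᴴ, F and Q (`rank_shift_le`), and the starting matrix has zero
off-diagonal blocks. With 2h shifts the rank is therefore at most ht, and σ_{ht+1} of the block is
at most the error (`sigma_succ_le_of_rank_le`).

Zolotarev: the h zeros and h poles of a rational function g, the zeros reflected in the imaginary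
axis, serve as the 2h shifts. The Blaschke product at d is then at most |g(d)|/|g(-d̄)|, and -d̄
lies in -E because E is symmetric under conjugation (`exists_shifts_mul_le`,
`le_mul_toReal_zolotarev`). As β ≤ 1, β² may be replaced by β. The factor κ_eig(C)² is at most the
constant of the theorem, since C is also the closed-loop matrix of the leading subproblem with j =
n.

Spectrum: the Riccati equation gives CᴴF⁻¹C = AᴴF⁻¹A + Q, and F⁻¹C differs from F⁻¹A by a Hermitian
matrix. Evaluated at an eigenvector, these identities bound |z| from above and |Re z| from below by
√(λ_min(Q)/‖F⁻¹‖) (`closedLoop_eigenvalue_bounds`); the bounds pass to principal submatrices. -/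

namespace Riccati

/-! ### One shift: error recursion and action of the Hamiltonian on graphs. -/

section ShiftStep

open Matrix
open scoped ComplexConjugate ComplexOrder

variable {ι : Type*} [Fintype ι] [DecidableEq ι]

/-- The Cayley transform `(C - p)⁻¹ (C + p̄)`. -/
noncomputable def cayley (C : Matrix ι ι ℂ) (p : ℂ) : Matrix ι ι ℂ :=
  (C - p • 1)⁻¹ * (C + conj p • 1)

/-- The Gramian increment `2 Re p (C - p)⁻¹ F (C - p)⁻ᴴ` of one shift. -/
noncomputable def shiftGram (C F : Matrix ι ι ℂ) (p : ℂ) : Matrix ι ι ℂ :=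
  ((2 * p.re : ℝ) : ℂ) • ((C - p • 1)⁻¹ * F * ((C - p • 1)⁻¹)ᴴ)

/-- The error of the approximate Riccati solution after one more shift. -/
noncomputable def shiftError (C F : Matrix ι ι ℂ) (p : ℂ) (E : Matrix ι ι ℂ) : Matrix ι ι ℂ :=
  (cayley C p)ᴴ * (E * (1 + shiftGram C F p * E)⁻¹) * cayley C p

lemma shiftGram_posSemidef {C F : Matrix ι ι ℂ} {p : ℂ} (hF : F.PosSemidef) (hp : 0 < p.re) :
    (shiftGram C F p).PosSemidef := by
  refine (hF.mul_mul_conjTranspose_same _).smul ?_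
  exact_mod_cast (by positivity : (0 : ℝ) ≤ 2 * p.re)

/-- If x + NEx = 0, pairing with Ex gives xᴴEx + (Ex)ᴴN(Ex) = 0. Both terms are nonnegative, so Ex =
0 and then x = 0. -/
lemma isUnit_one_add_mul {N E : Matrix ι ι ℂ} (hN : N.PosSemidef) (hE : E.PosSemidef) :
    IsUnit (1 + N * E) := by
  rw [← Matrix.mulVec_injective_iff_isUnit]
  refine (injective_iff_map_eq_zero (Matrix.mulVecLin (1 + N * E))).2 fun x hx => ?_
  simp only [mulVecLin_apply, add_mulVec, one_mulVec, ← mulVec_mulVec] at hx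
  have h1 : star (E *ᵥ x) ⬝ᵥ x + star (E *ᵥ x) ⬝ᵥ (N *ᵥ (E *ᵥ x)) = 0 := by
    rw [← dotProduct_add, hx, dotProduct_zero]
  have h2 : star (E *ᵥ x) ⬝ᵥ x = star x ⬝ᵥ (E *ᵥ x) := by
    rw [star_mulVec, hE.isHermitian.eq, dotProduct_mulVec]
  have h3 := hE.dotProduct_mulVec_nonneg x
  have h4 := hN.dotProduct_mulVec_nonneg (E *ᵥ x)
  rw [h2] at h1
  have h5 : star x ⬝ᵥ (E *ᵥ x) = 0 :=
    le_antisymm (by rw [eq_neg_of_add_eq_zero_left h1]; exact neg_nonpos.2 h4) h3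
  have h6 : E *ᵥ x = 0 := (hE.dotProduct_mulVec_zero_iff x).1 h5
  simpa [h6] using hx

/-- With W = (1 + NE)⁻¹ both matrices are congruences of visibly semidefinite ones: EW = Wᴴ(E +
ENE)W and E - EW = Wᴴ(ENE + ENENE)W. -/
lemma mul_inv_one_add_posSemidef {N E : Matrix ι ι ℂ} (hN : N.PosSemidef) (hE : E.PosSemidef) :
    (E * (1 + N * E)⁻¹).PosSemidef ∧ (E - E * (1 + N * E)⁻¹).PosSemidef := by
  set W := (1 + N * E)⁻¹ with hW
  have hu := (Matrix.isUnit_iff_isUnit_det _).1 (isUnit_one_add_mul hN hE)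
  have h1 : (1 + N * E) * W = 1 := Matrix.mul_nonsing_inv _ hu
  have h1' : W * (1 + N * E) = 1 := Matrix.nonsing_inv_mul _ hu
  have h2 : Wᴴ * (1 + E * N) = 1 := by
    have := congrArg conjTranspose h1
    simpa [conjTranspose_mul, hN.isHermitian.eq, hE.isHermitian.eq] using this
  have h3 : E * W = Wᴴ * (E + E * N * E) * W := by
    calc E * W = (Wᴴ * (1 + E * N)) * E * W := by rw [h2, one_mul]
      _ = _ := by noncomm_ring
  have h4 : E - E * W = Wᴴ * (E * N * E + E * N * E * N * E) * W := by
    have e1 : E - E * W = E * (N * E) * W := by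
      calc E - E * W = E * ((1 + N * E) * W) - E * W := by rw [h1, mul_one]
        _ = _ := by noncomm_ring
    calc E - E * W = (Wᴴ * (1 + E * N)) * (E * (N * E) * W) := by rw [h2, one_mul, e1]
      _ = _ := by noncomm_ring
  have hENE : (E * N * E).PosSemidef := by
    have := hN.mul_mul_conjTranspose_same E
    rwa [hE.isHermitian.eq] at this
  have hENENE : (E * N * E * N * E).PosSemidef := by
    have := hE.mul_mul_conjTranspose_same (E * N)
    rw [conjTranspose_mul, hE.isHermitian.eq, hN.isHermitian.eq] at this
    convert this using 1
    noncomm_ring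
  constructor
  · rw [h3]; exact (hE.add hENE).conjTranspose_mul_mul_same W
  · rw [h4]; exact (hENE.add hENENE).conjTranspose_mul_mul_same W

lemma shiftError_posSemidef {C F E : Matrix ι ι ℂ} {p : ℂ} (hF : F.PosSemidef) (hp : 0 < p.re)
    (hE : E.PosSemidef) : (shiftError C F p E).PosSemidef :=
  (mul_inv_one_add_posSemidef (shiftGram_posSemidef hF hp) hE).1.conjTranspose_mul_mul_same _

lemma shiftError_le {C F E : Matrix ι ι ℂ} {p : ℂ} (hF : F.PosSemidef) (hp : 0 < p.re)
    (hE : E.PosSemidef) :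
    ((cayley C p)ᴴ * E * cayley C p - shiftError C F p E).PosSemidef := by
  have := (mul_inv_one_add_posSemidef (shiftGram_posSemidef (C := C) hF hp)
    hE).2.conjTranspose_mul_mul_same (cayley C p)
  rwa [mul_sub, sub_mul] at this

lemma cayley_mul_sub {C : Matrix ι ι ℂ} {p : ℂ} (h : IsUnit (C - p • 1)) :
    cayley C p * (C - p • 1) = C + conj p • 1 := by
  have hu := (Matrix.isUnit_iff_isUnit_det _).1 h
  have hc : (C + conj p • 1) * (C - p • 1) = (C - p • 1) * (C + conj p • 1) := by
    simp only [mul_add, add_mul, mul_sub, sub_mul, smul_mul_assoc, mul_smul_comm, one_mul, mul_one]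
    module
  rw [cayley, mul_assoc, hc, ← mul_assoc, Matrix.nonsing_inv_mul _ hu, one_mul]

/-- One shift maps the graph of `X + E` under the Hamiltonian into the graph of
`X + shiftError E`. -/
lemma shift_graph {A F Q X : Matrix ι ι ℂ} (hX : X.IsHermitian) (hF : F.PosSemidef)
    (hcare : Aᴴ * X + X * A - X * F * X + Q = 0) {p : ℂ} (hp : 0 < p.re)
    (hC : IsUnit (A - F * X - p • 1)) {E : Matrix ι ι ℂ} (hE : E.PosSemidef) {a b : ι → ℂ}
    (hab : -(Q *ᵥ a) - Aᴴ *ᵥ b + conj p • b = (X + E) *ᵥ (A *ᵥ a - F *ᵥ b + conj p • a)) :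
    -(Q *ᵥ a) - Aᴴ *ᵥ b - p • b =
      (X + shiftError (A - F * X) F p E) *ᵥ (A *ᵥ a - F *ᵥ b - p • a) := by
  set C := A - F * X with hCdef
  -- Coordinates relative to the graph of X: by the Riccati equation the Hamiltonian becomes block
  -- triangular, (a, q) ↦ (Ca - Fq, -Cᴴq).
  obtain ⟨q, rfl⟩ : ∃ q, b = X *ᵥ a + q := ⟨b - X *ᵥ a, by abel⟩
  have hCH : Cᴴ = Aᴴ - X * F := by
    simp [hCdef, conjTranspose_mul, hX.eq, hF.isHermitian.eq]
  have hQ : Q = X * F * X - Aᴴ * X - X * A := by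
    rw [← sub_eq_zero, ← hcare]; abel
  have key : ∀ c : ℂ, -(Q *ᵥ a) - Aᴴ *ᵥ (X *ᵥ a + q) + c • (X *ᵥ a + q) =
      X *ᵥ (A *ᵥ a - F *ᵥ (X *ᵥ a + q) + c • a) + (c • q - Cᴴ *ᵥ q) := by
    intro c
    rw [hQ, hCH]
    simp only [sub_mulVec, mulVec_add, mulVec_sub, mulVec_smul, ← mulVec_mulVec, smul_add]
    abel
  have hfirst : ∀ c : ℂ, A *ᵥ a - F *ᵥ (X *ᵥ a + q) + c • a = C *ᵥ a - F *ᵥ q + c • a := by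
    intro c
    simp only [hCdef, sub_mulVec, mulVec_add, ← mulVec_mulVec]; abel
  set g := C *ᵥ a - F *ᵥ q + conj p • a with hg
  set s := C *ᵥ a - F *ᵥ q - p • a with hs
  set R := C - p • (1 : Matrix ι ι ℂ) with hR
  have hRd := (Matrix.isUnit_iff_isUnit_det _).1 hC
  have hRH : Rᴴ = Cᴴ - conj p • 1 := by simp [hR]
  have hq : -(Rᴴ *ᵥ q) = E *ᵥ g := by
    rw [key, hfirst, add_mulVec, ← hg] at hab
    rw [← add_left_cancel hab, hRH]
    simp [sub_mulVec, smul_mulVec]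
  have hkey' := key (-p)
  have hfirst' := hfirst (-p)
  simp only [neg_smul, ← sub_eq_add_neg] at hkey' hfirst'
  rw [hkey', hfirst', add_mulVec, ← hs]
  congr 1
  have hRT : R * cayley C p = C + conj p • 1 := by
    rw [cayley, ← mul_assoc, Matrix.mul_nonsing_inv _ hRd, one_mul]
  have hTR : (cayley C p)ᴴ * Rᴴ = Cᴴ + p • 1 := by
    rw [← conjTranspose_mul, hRT]; simp
  have hT : cayley C p = 1 + ((2 * p.re : ℝ) : ℂ) • R⁻¹ := by
    have h1 : C + conj p • 1 = R + ((2 * p.re : ℝ) : ℂ) • (1 : Matrix ι ι ℂ) := by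
      rw [hR, ← Complex.add_conj p, add_smul]; abel
    rw [cayley, h1, mul_add, Matrix.nonsing_inv_mul _ hRd, mul_smul_comm, mul_one]
  have hN : shiftGram C F p * Rᴴ = ((2 * p.re : ℝ) : ℂ) • (R⁻¹ * F) := by
    rw [shiftGram, smul_mul_assoc, mul_assoc, ← conjTranspose_mul, Matrix.mul_nonsing_inv _ hRd,
      conjTranspose_one, mul_one]
  -- This identity dictates the form of `shiftError`: it turns (1 + NE)⁻¹Ts into g, and Eg = -Rᴴq is
  -- known from the hypothesis.
  have hTs : cayley C p *ᵥ s = (1 + shiftGram C F p * E) *ᵥ g := by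
    have h1 : s = R *ᵥ a - F *ᵥ q := by
      rw [hs, hR, sub_mulVec C, smul_mulVec, one_mulVec]; abel
    have h2 : (shiftGram C F p * E) *ᵥ g = -(((2 * p.re : ℝ) : ℂ) • (R⁻¹ *ᵥ F *ᵥ q)) := by
      rw [← mulVec_mulVec, ← hq, mulVec_neg, mulVec_mulVec, hN, smul_mulVec, mulVec_mulVec]
    rw [h1, mulVec_sub, mulVec_mulVec, cayley_mul_sub hC, add_mulVec 1, h2, one_mulVec, hT]
    simp only [add_mulVec, smul_mulVec, one_mulVec, hg]
    abel
  have hu := (Matrix.isUnit_iff_isUnit_det _).1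
    (isUnit_one_add_mul (shiftGram_posSemidef (C := C) hF hp) hE)
  have h3 : shiftError C F p E *ᵥ s = (cayley C p)ᴴ *ᵥ (E *ᵥ g) := by
    rw [shiftError, ← mulVec_mulVec, hTs, mulVec_mulVec, mul_assoc, mul_assoc,
      Matrix.nonsing_inv_mul _ hu, mul_one, mulVec_mulVec]
  rw [h3, ← hq, mulVec_neg, mulVec_mulVec, hTR, add_mulVec, smul_mulVec, one_mulVec]
  abel

/-- The shifted graph map is injective on the preimage of the graph. -/
lemma shift_injective {A F Q X : Matrix ι ι ℂ} (hX : X.IsHermitian) (hF : F.PosDef)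
    (hcare : Aᴴ * X + X * A - X * F * X + Q = 0) {p : ℂ} (hp : 0 < p.re)
    (hC : IsUnit (A - F * X - p • 1)) {E : Matrix ι ι ℂ} (hE : E.PosSemidef) {a b : ι → ℂ}
    (hab : -(Q *ᵥ a) - Aᴴ *ᵥ b + conj p • b = (X + E) *ᵥ (A *ᵥ a - F *ᵥ b + conj p • a))
    (h0 : A *ᵥ a - F *ᵥ b - p • a = 0) : a = 0 ∧ b = 0 := by
  -- The second component of (H - p)(a, b) vanishes as well, so (a, b) satisfies the eigenvector
  -- equation of H for p, and H + p̄ acts on it as 2 Re p.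
  have hgr := shift_graph hX hF.posSemidef hcare hp hC hE hab
  rw [h0, mulVec_zero] at hgr
  set C := A - F * X with hCdef
  obtain ⟨q, rfl⟩ : ∃ q, b = X *ᵥ a + q := ⟨b - X *ᵥ a, by abel⟩
  have hCH : Cᴴ = Aᴴ - X * F := by
    simp [hCdef, conjTranspose_mul, hX.eq, hF.isHermitian.eq]
  have hQ : Q = X * F * X - Aᴴ * X - X * A := by
    rw [← sub_eq_zero, ← hcare]; abel
  have hadd : conj p = ((2 * p.re : ℝ) : ℂ) - p := by rw [← Complex.add_conj p]; ring
  have hpos : (0 : ℝ) < 2 * p.re := by positivity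
  have hne : ((2 * p.re : ℝ) : ℂ) ≠ 0 := by exact_mod_cast hpos.ne'
  have h1 : C *ᵥ a - F *ᵥ q = p • a := by
    rw [← sub_eq_zero, ← h0]
    simp only [hCdef, sub_mulVec, mulVec_add, ← mulVec_mulVec]; abel
  have h2 : Cᴴ *ᵥ q = -(p • q) := by
    have h5 : A *ᵥ a = p • a + F *ᵥ (X *ᵥ a + q) := by
      rw [eq_comm, ← sub_eq_zero, ← neg_eq_zero, ← h0]; abel
    have h4 : -(Q *ᵥ a) - Aᴴ *ᵥ (X *ᵥ a + q) - p • (X *ᵥ a + q) = -(Cᴴ *ᵥ q + p • q) := by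
      rw [hQ, hCH]
      simp only [sub_mulVec, mulVec_add, ← mulVec_mulVec, smul_add, h5, mulVec_smul]
      abel
    rw [h4, neg_eq_zero] at hgr
    exact eq_neg_of_add_eq_zero_left hgr
  have h3 : q = E *ᵥ a := by
    have e1 : A *ᵥ a - F *ᵥ (X *ᵥ a + q) + conj p • a = ((2 * p.re : ℝ) : ℂ) • a := by
      rw [hadd, sub_smul, ← sub_eq_zero, ← h0]; abel
    have e2 : -(Q *ᵥ a) - Aᴴ *ᵥ (X *ᵥ a + q) + conj p • (X *ᵥ a + q) =
        ((2 * p.re : ℝ) : ℂ) • (X *ᵥ a + q) := by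
      rw [hadd, sub_smul, ← sub_eq_zero, ← hgr]; abel
    rw [e1, e2, mulVec_smul, add_mulVec] at hab
    exact add_left_cancel (smul_right_injective _ hne hab)
  -- Pairing Ca - Fq = pa with q, and using Cᴴq = -pq and q = Ea, equates a nonnegative number with
  -- a nonpositive one.
  have h4 : star q ⬝ᵥ (F *ᵥ q) = -(((2 * p.re : ℝ) : ℂ) * (star a ⬝ᵥ (E *ᵥ a))) := by
    have e1 : star q ⬝ᵥ (C *ᵥ a) = -(conj p * (star q ⬝ᵥ a)) := by
      rw [dotProduct_mulVec, ← star_star (star q ᵥ* C), star_vecMul, star_star, h2, star_neg,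
        star_smul, neg_dotProduct, smul_dotProduct]
      rfl
    have e2 : star q ⬝ᵥ a = star a ⬝ᵥ (E *ᵥ a) := by
      rw [h3, star_mulVec, hE.isHermitian.eq, dotProduct_mulVec]
    have e3 := congrArg (fun v => star q ⬝ᵥ v) h1
    simp only [dotProduct_sub, dotProduct_smul, e1, e2, smul_eq_mul] at e3
    rw [hadd] at e3
    linear_combination -e3
  have h5 : q = 0 := by
    by_contra hq0
    have e1 := hF.dotProduct_mulVec_pos hq0
    have e2 := hE.dotProduct_mulVec_nonneg a
    have e3 : (0 : ℂ) ≤ ((2 * p.re : ℝ) : ℂ) := by exact_mod_cast hpos.le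
    rw [h4] at e1
    exact absurd (mul_nonneg e3 e2) (not_le_of_gt (neg_pos.1 e1))
  have h6 : a = 0 := by
    refine (injective_iff_map_eq_zero (Matrix.mulVecLin (C - p • 1))).1
      ((Matrix.mulVec_injective_iff_isUnit).2 hC) a ?_
    rw [h5, mulVec_zero, sub_zero] at h1
    simp [h1]
  refine ⟨h6, ?_⟩
  rw [h6, h5]; simp

end ShiftStep

/-! ### Rank growth of off-diagonal blocks under one shift. -/

section ShiftRank

open Matrix Module
open scoped ComplexConjugate ComplexOrder

lemma finrank_le_finrank_inf_ker {K V W : Type*} [Field K] [AddCommGroup V] [Module K V]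
    [FiniteDimensional K V] [AddCommGroup W] [Module K W] [FiniteDimensional K W]
    (S : Submodule K V) (f : V →ₗ[K] W) :
    finrank K S ≤ finrank K (S ⊓ LinearMap.ker f : Submodule K V) +
      finrank K (LinearMap.range f) := by
  have h1 := LinearMap.finrank_range_add_finrank_ker (f.domRestrict S)
  have h2 : finrank K (LinearMap.range (f.domRestrict S)) ≤ finrank K (LinearMap.range f) := by
    refine Submodule.finrank_mono ?_
    rintro _ ⟨x, rfl⟩
    exact ⟨x, rfl⟩
  have h3 : finrank K (LinearMap.ker (f.domRestrict S)) ≤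
      finrank K (S ⊓ LinearMap.ker f : Submodule K V) := by
    rw [← Submodule.finrank_map_subtype_eq]
    refine Submodule.finrank_mono ?_
    rintro _ ⟨x, hx, rfl⟩
    exact ⟨x.2, by simpa using hx⟩
  omega

lemma finrank_range_mulVecLin_comp_le {V : Type*} [AddCommGroup V] [Module ℂ V]
    {m k : Type*} [Fintype m] [Fintype k] (M : Matrix m k ℂ) (f : V →ₗ[ℂ] (k → ℂ)) :
    finrank ℂ (LinearMap.range (M.mulVecLin ∘ₗ f)) ≤ M.rank :=
  Submodule.finrank_mono (LinearMap.range_comp_le_range _ _)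

variable {ι κ₁ κ₂ : Type*} [Fintype ι] [DecidableEq ι] [Fintype κ₁] [DecidableEq κ₁] [Fintype κ₂]

/-- One shift increases the rank of an off-diagonal block of the approximate Riccati solution at
most by the ranks of the off-diagonal blocks of the Hamiltonian. -/
lemma rank_shift_le {A F Q X : Matrix ι ι ℂ} (hX : X.IsHermitian) (hF : F.PosDef)
    (hcare : Aᴴ * X + X * A - X * F * X + Q = 0) {p : ℂ} (hp : 0 < p.re)
    (hC : IsUnit (A - F * X - p • 1)) {E : Matrix ι ι ℂ} (hE : E.PosSemidef)
    {J₁ : Matrix ι κ₁ ℂ} {J₂ : Matrix ι κ₂ ℂ} (h₁ : J₁ᴴ * J₁ = 1)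
    (h₂₁ : J₂ᴴ * J₁ = 0) (hJ : J₁ * J₁ᴴ + J₂ * J₂ᴴ = 1) :
    (J₂ᴴ * (X + shiftError (A - F * X) F p E) * J₁).rank ≤
      (J₂ᴴ * (X + E) * J₁).rank + ((J₂ᴴ * A * J₁).rank + (J₂ᴴ * Aᴴ * J₁).rank +
        (J₂ᴴ * F * J₁).rank + (J₂ᴴ * Q * J₁).rank) := by
  set P := X + E with hP
  set P' := X + shiftError (A - F * X) F p E with hP'
  -- Pairs (a, b) supported on the first index block. `first c` and `second c` are the two
  -- components of (H + c)(a, b).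
  let V := (κ₁ → ℂ) × (κ₁ → ℂ)
  let fa : V →ₗ[ℂ] (κ₁ → ℂ) := LinearMap.fst ℂ _ _
  let fb : V →ₗ[ℂ] (κ₁ → ℂ) := LinearMap.snd ℂ _ _
  let first (c : ℂ) : V →ₗ[ℂ] (ι → ℂ) :=
    A.mulVecLin ∘ₗ J₁.mulVecLin ∘ₗ fa - F.mulVecLin ∘ₗ J₁.mulVecLin ∘ₗ fb +
      c • J₁.mulVecLin ∘ₗ fa
  let second (c : ℂ) : V →ₗ[ℂ] (ι → ℂ) :=
    -(Q.mulVecLin ∘ₗ J₁.mulVecLin ∘ₗ fa) - Aᴴ.mulVecLin ∘ₗ J₁.mulVecLin ∘ₗ fb +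
      c • J₁.mulVecLin ∘ₗ fb
  -- On the kernels of `c₁` to `c₄`, H maps into pairs supported on the first block. Then `c₅` and
  -- `c₆` express the second-block and first-block rows of membership of (H + p̄)(a, b) in the graph
  -- of P. The condition `c₆` costs at most the size of the first block, half the dimension of `V`.
  let c₁ := (J₂ᴴ * A * J₁).mulVecLin ∘ₗ fa
  let c₂ := (J₂ᴴ * F * J₁).mulVecLin ∘ₗ fb
  let c₃ := (J₂ᴴ * Q * J₁).mulVecLin ∘ₗ fa
  let c₄ := (J₂ᴴ * Aᴴ * J₁).mulVecLin ∘ₗ fb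
  let c₅ := (J₂ᴴ * P * J₁).mulVecLin ∘ₗ (J₁ᴴ.mulVecLin ∘ₗ first (conj p))
  let c₆ := J₁ᴴ.mulVecLin ∘ₗ (second (conj p) - P.mulVecLin ∘ₗ first (conj p))
  let S : Submodule ℂ V := ((((((⊤ ⊓ LinearMap.ker c₁) ⊓ LinearMap.ker c₂) ⊓ LinearMap.ker c₃) ⊓
    LinearMap.ker c₄) ⊓ LinearMap.ker c₅) ⊓ LinearMap.ker c₆)
  have hdim : 2 * Fintype.card κ₁ ≤ finrank ℂ S + (J₂ᴴ * A * J₁).rank + (J₂ᴴ * F * J₁).rank +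
      (J₂ᴴ * Q * J₁).rank + (J₂ᴴ * Aᴴ * J₁).rank + (J₂ᴴ * P * J₁).rank + Fintype.card κ₁ := by
    have e0 : finrank ℂ (⊤ : Submodule ℂ V) = 2 * Fintype.card κ₁ := by
      rw [finrank_top, Module.finrank_prod, Module.finrank_fintype_fun_eq_card, two_mul]
    have e1 := finrank_le_finrank_inf_ker ⊤ c₁
    have e2 := finrank_le_finrank_inf_ker (⊤ ⊓ LinearMap.ker c₁) c₂
    have e3 := finrank_le_finrank_inf_ker ((⊤ ⊓ LinearMap.ker c₁) ⊓ LinearMap.ker c₂) c₃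
    have e4 := finrank_le_finrank_inf_ker
      (((⊤ ⊓ LinearMap.ker c₁) ⊓ LinearMap.ker c₂) ⊓ LinearMap.ker c₃) c₄
    have e5 := finrank_le_finrank_inf_ker
      ((((⊤ ⊓ LinearMap.ker c₁) ⊓ LinearMap.ker c₂) ⊓ LinearMap.ker c₃) ⊓ LinearMap.ker c₄) c₅
    have e6 := finrank_le_finrank_inf_ker
      (((((⊤ ⊓ LinearMap.ker c₁) ⊓ LinearMap.ker c₂) ⊓ LinearMap.ker c₃) ⊓ LinearMap.ker c₄) ⊓
        LinearMap.ker c₅) c₆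
    have r1 : finrank ℂ (LinearMap.range c₁) ≤ _ := finrank_range_mulVecLin_comp_le _ _
    have r2 : finrank ℂ (LinearMap.range c₂) ≤ _ := finrank_range_mulVecLin_comp_le _ _
    have r3 : finrank ℂ (LinearMap.range c₃) ≤ _ := finrank_range_mulVecLin_comp_le _ _
    have r4 : finrank ℂ (LinearMap.range c₄) ≤ _ := finrank_range_mulVecLin_comp_le _ _
    have r5 : finrank ℂ (LinearMap.range c₅) ≤ _ := finrank_range_mulVecLin_comp_le _ _
    have r6 : finrank ℂ (LinearMap.range c₆) ≤ Fintype.card κ₁ :=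
      (Submodule.finrank_le _).trans (Module.finrank_fintype_fun_eq_card ℂ).le
    have hS : finrank ℂ S = finrank ℂ ((((((⊤ ⊓ LinearMap.ker c₁) ⊓ LinearMap.ker c₂) ⊓
      LinearMap.ker c₃) ⊓ LinearMap.ker c₄) ⊓ LinearMap.ker c₅) ⊓ LinearMap.ker c₆ :
        Submodule ℂ V) := rfl
    omega
  have hproj : ∀ x : ι → ℂ, J₂ᴴ *ᵥ x = 0 → J₁ *ᵥ (J₁ᴴ *ᵥ x) = x := by
    intro x hx
    have : (J₁ * J₁ᴴ + J₂ * J₂ᴴ) *ᵥ x = x := by rw [hJ, one_mulVec]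
    rwa [add_mulVec, ← mulVec_mulVec, ← mulVec_mulVec, hx, mulVec_zero, add_zero] at this
  have hoff : ∀ y ∈ S, ∀ c : ℂ, J₂ᴴ *ᵥ first c y = 0 ∧ J₂ᴴ *ᵥ second c y = 0 := by
    rintro y ⟨⟨⟨⟨⟨⟨-, k1⟩, k2⟩, k3⟩, k4⟩, -⟩, -⟩ c
    have k1' : (J₂ᴴ * A * J₁) *ᵥ y.1 = 0 := k1
    have k2' : (J₂ᴴ * F * J₁) *ᵥ y.2 = 0 := k2
    have k3' : (J₂ᴴ * Q * J₁) *ᵥ y.1 = 0 := k3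
    have k4' : (J₂ᴴ * Aᴴ * J₁) *ᵥ y.2 = 0 := k4
    have e1 : first c y = A *ᵥ J₁ *ᵥ y.1 - F *ᵥ J₁ *ᵥ y.2 + c • J₁ *ᵥ y.1 := rfl
    have e2 : second c y = -(Q *ᵥ J₁ *ᵥ y.1) - Aᴴ *ᵥ J₁ *ᵥ y.2 + c • J₁ *ᵥ y.2 := rfl
    rw [e1, e2]
    simp only [mulVec_add, mulVec_sub, mulVec_neg, mulVec_smul, mulVec_mulVec, ← Matrix.mul_assoc,
      k1', k2', k3', k4', h₂₁, zero_mulVec, smul_zero, add_zero, sub_zero, neg_zero, and_self]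
  have hgraph : ∀ y ∈ S, second (conj p) y = P *ᵥ first (conj p) y := by
    intro y hy
    have hy' := hy
    obtain ⟨⟨-, k5⟩, k6⟩ := hy'
    have k5' : (J₂ᴴ * P * J₁) *ᵥ (J₁ᴴ *ᵥ first (conj p) y) = 0 := k5
    have k6' : J₁ᴴ *ᵥ (second (conj p) y - P *ᵥ first (conj p) y) = 0 := k6
    have e1 := hproj (second (conj p) y - P *ᵥ first (conj p) y) (by
      rw [mulVec_sub, (hoff y hy _).2, zero_sub, neg_eq_zero, ← k5', ← mulVec_mulVec,
        hproj _ (hoff y hy _).1, mulVec_mulVec])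
    rw [k6', mulVec_zero] at e1
    exact sub_eq_zero.1 e1.symm
  have hgraph' : ∀ y ∈ S, second (-p) y = P' *ᵥ first (-p) y := by
    intro y hy
    have := shift_graph hX hF.posSemidef hcare hp hC hE (a := J₁ *ᵥ y.1) (b := J₁ *ᵥ y.2)
      (hgraph y hy)
    have e1 : first (-p) y = A *ᵥ J₁ *ᵥ y.1 - F *ᵥ J₁ *ᵥ y.2 - p • J₁ *ᵥ y.1 := by
      rw [sub_eq_add_neg _ (p • _), ← neg_smul]; rfl
    have e2 : second (-p) y = -(Q *ᵥ J₁ *ᵥ y.1) - Aᴴ *ᵥ J₁ *ᵥ y.2 - p • J₁ *ᵥ y.2 := by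
      rw [sub_eq_add_neg _ (p • _), ← neg_smul]; rfl
    rw [e1, e2]; exact this
  -- (H - p)(a, b) lies in the graph of P' and both its components are supported on the first block.
  -- Hence its first component is in the kernel of the off-diagonal block of P', and the nullity of
  -- that block is at least dim S.
  let φ : S →ₗ[ℂ] (κ₁ → ℂ) := (J₁ᴴ.mulVecLin ∘ₗ first (-p)).domRestrict S
  have hφ : LinearMap.range φ ≤ LinearMap.ker (J₂ᴴ * P' * J₁).mulVecLin := by
    rintro _ ⟨⟨y, hy⟩, rfl⟩
    change (J₂ᴴ * P' * J₁) *ᵥ (J₁ᴴ *ᵥ first (-p) y) = 0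
    rw [← mulVec_mulVec, hproj _ (hoff y hy _).1, ← mulVec_mulVec, ← hgraph' y hy,
      (hoff y hy _).2]
  have hinj : Function.Injective φ := by
    refine (injective_iff_map_eq_zero φ).2 ?_
    rintro ⟨y, hy⟩ h0
    have h0' : J₁ᴴ *ᵥ first (-p) y = 0 := h0
    have h0'' : first (-p) y = 0 := by rw [← hproj _ (hoff y hy _).1, h0', mulVec_zero]
    have e1 : first (-p) y = A *ᵥ J₁ *ᵥ y.1 - F *ᵥ J₁ *ᵥ y.2 - p • J₁ *ᵥ y.1 := by
      rw [sub_eq_add_neg _ (p • _), ← neg_smul]; rfl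
    obtain ⟨i1, i2⟩ := shift_injective hX hF hcare hp hC hE (a := J₁ *ᵥ y.1) (b := J₁ *ᵥ y.2)
      (hgraph y hy) (by rw [← e1, h0''])
    have cancel : ∀ v : κ₁ → ℂ, J₁ *ᵥ v = 0 → v = 0 := by
      intro v hv
      rw [← one_mulVec v, ← h₁, ← mulVec_mulVec, hv, mulVec_zero]
    ext1
    exact Prod.ext (cancel _ i1) (cancel _ i2)
  have hk : finrank ℂ S ≤ finrank ℂ (LinearMap.ker (J₂ᴴ * P' * J₁).mulVecLin) := by
    rw [← LinearMap.finrank_range_of_inj hinj]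
    exact Submodule.finrank_mono hφ
  have hrn := LinearMap.finrank_range_add_finrank_ker (J₂ᴴ * P' * J₁).mulVecLin
  rw [Module.finrank_fintype_fun_eq_card] at hrn
  have hr : (J₂ᴴ * P' * J₁).rank = finrank ℂ (LinearMap.range (J₂ᴴ * P' * J₁).mulVecLin) := rfl
  omega

end ShiftRank

/-! ### Several shifts and the resulting low-rank approximation. -/

section Iteration

open Matrix
open scoped ComplexConjugate ComplexOrder MatrixOrder

variable {ι κ₁ κ₂ : Type*} [Fintype ι] [DecidableEq ι] [Fintype κ₁] [DecidableEq κ₁] [Fintype κ₂]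

lemma exists_shifted_error {A F Q X : Matrix ι ι ℂ} (hX : X.IsHermitian) (hF : F.PosDef)
    (hcare : Aᴴ * X + X * A - X * F * X + Q = 0)
    {J₁ : Matrix ι κ₁ ℂ} {J₂ : Matrix ι κ₂ ℂ} (h₁ : J₁ᴴ * J₁ = 1)
    (h₂₁ : J₂ᴴ * J₁ = 0) (hJ : J₁ * J₁ᴴ + J₂ * J₂ᴴ = 1) (ps : List ℂ) :
    ∀ E₀ : Matrix ι ι ℂ, E₀.PosSemidef →
      (∀ p ∈ ps, 0 < p.re ∧ IsUnit (A - F * X - p • 1)) →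
      ∃ E : Matrix ι ι ℂ, 0 ≤ E ∧
        E ≤ ((ps.map (cayley (A - F * X))).prod)ᴴ * E₀ * (ps.map (cayley (A - F * X))).prod ∧
        (J₂ᴴ * (X + E) * J₁).rank ≤ (J₂ᴴ * (X + E₀) * J₁).rank +
          ps.length * ((J₂ᴴ * A * J₁).rank + (J₂ᴴ * Aᴴ * J₁).rank +
            (J₂ᴴ * F * J₁).rank + (J₂ᴴ * Q * J₁).rank) := by
  induction ps with
  | nil => exact fun E₀ h0 _ => ⟨E₀, h0.nonneg, by simp, by simp⟩
  | cons p ps ih =>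
    intro E₀ h0 hps
    obtain ⟨hp, hu⟩ := hps p (by simp)
    have hle := shiftError_le (C := A - F * X) hF.posSemidef hp h0
    have hr := rank_shift_le hX hF hcare hp hu h0 h₁ h₂₁ hJ
    obtain ⟨E, hE0, hE, hrk⟩ := ih (shiftError (A - F * X) F p E₀)
      (shiftError_posSemidef hF.posSemidef hp h0) (fun q hq => hps q (by simp [hq]))
    refine ⟨E, hE0, hE.trans ?_, ?_⟩
    · have := hle.conjTranspose_mul_mul_same (ps.map (cayley (A - F * X))).prod
      rw [mul_sub, sub_mul] at this
      have e : (((p :: ps).map (cayley (A - F * X))).prod)ᴴ * E₀ *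
          ((p :: ps).map (cayley (A - F * X))).prod = ((ps.map (cayley (A - F * X))).prod)ᴴ *
          ((cayley (A - F * X) p)ᴴ * E₀ * cayley (A - F * X) p) *
          (ps.map (cayley (A - F * X))).prod := by
        rw [List.map_cons, List.prod_cons, conjTranspose_mul]
        noncomm_ring
      rw [e]
      exact Matrix.le_iff.2 this
    · rw [List.length_cons, add_mul, one_mul]
      omega

lemma cayley_mul_of_diagonalizes {C V : Matrix ι ι ℂ} {d : ι → ℂ} (h : C * V = V * diagonal d)
    {p : ℂ} (hp : ∀ i, d i ≠ p) (hu : IsUnit (C - p • 1)) :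
    cayley C p * V = V * diagonal (fun i => (d i + conj p) / (d i - p)) := by
  have e1 : (C + conj p • 1) * V = V * diagonal (fun i => d i + conj p) := by
    rw [add_mul, h]
    ext i j
    simp [mul_diagonal]
    ring
  have e2 : (C - p • 1) * V = V * diagonal (fun i => d i - p) := by
    rw [sub_mul, h]
    ext i j
    simp [mul_diagonal]
    ring
  have hd := (Matrix.isUnit_iff_isUnit_det _).1 hu
  have e3 : (C - p • 1)⁻¹ * V = V * diagonal (fun i => (d i - p)⁻¹) := by
    have : V = (C - p • 1) * (V * diagonal (fun i => (d i - p)⁻¹)) := by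
      rw [← mul_assoc, e2, mul_assoc, diagonal_mul_diagonal]
      have : (fun i => (d i - p) * (d i - p)⁻¹) = fun _ => 1 := by
        funext i
        exact mul_inv_cancel₀ (sub_ne_zero.2 (hp i))
      rw [this, diagonal_one, mul_one]
    conv_lhs => rw [this]
    rw [← mul_assoc, Matrix.nonsing_inv_mul _ hd, one_mul]
  rw [cayley, mul_assoc, e1, ← mul_assoc, e3, mul_assoc, diagonal_mul_diagonal]
  congr 2
  funext i
  rw [div_eq_inv_mul]

lemma prod_cayley_mul_of_diagonalizes {C V : Matrix ι ι ℂ} {d : ι → ℂ}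
    (h : C * V = V * diagonal d) (ps : List ℂ)
    (hps : ∀ p ∈ ps, (∀ i, d i ≠ p) ∧ IsUnit (C - p • 1)) :
    (ps.map (cayley C)).prod * V =
      V * diagonal (fun i => (ps.map fun p => (d i + conj p) / (d i - p)).prod) := by
  induction ps with
  | nil => simp
  | cons p ps ih =>
    obtain ⟨h1, h2⟩ := hps p (by simp)
    rw [List.map_cons, List.prod_cons, mul_assoc, ih fun q hq => hps q (by simp [hq]),
      ← mul_assoc, cayley_mul_of_diagonalizes h h1 h2, mul_assoc, diagonal_mul_diagonal]
    simp

lemma isUnit_sub_of_diagonalizes {C V : Matrix ι ι ℂ} {d : ι → ℂ} (hV : IsUnit V)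
    (h : C * V = V * diagonal d) {p : ℂ} (hp : ∀ i, d i ≠ p) : IsUnit (C - p • 1) := by
  have e2 : (C - p • 1) * V = V * diagonal (fun i => d i - p) := by
    rw [sub_mul, h]
    ext i j
    simp [mul_diagonal]
    ring
  have hd : IsUnit (diagonal (fun i => d i - p)) := by
    rw [Matrix.isUnit_iff_isUnit_det, det_diagonal, isUnit_iff_ne_zero]
    exact Finset.prod_ne_zero_iff.2 fun i _ => sub_ne_zero.2 (hp i)
  have hVd := (Matrix.isUnit_iff_isUnit_det _).1 hV
  have : C - p • 1 = V * diagonal (fun i => d i - p) * V⁻¹ := by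
    rw [← e2, mul_assoc, Matrix.mul_nonsing_inv _ hVd, mul_one]
  rw [this]
  exact (hV.mul hd).mul ((Matrix.isUnit_nonsing_inv_iff).2 hV)

/-- An approximate solution of the Riccati equation with an off-diagonal block of low rank, and a
bound on its error in terms of the shifts. -/
theorem exists_low_rank_approximation {A F Q X V : Matrix ι ι ℂ} {d : ι → ℂ}
    (hX : X.PosSemidef) (hF : F.PosDef)
    (hcare : Aᴴ * X + X * A - X * F * X + Q = 0)
    {J₁ : Matrix ι κ₁ ℂ} {J₂ : Matrix ι κ₂ ℂ} (h₁ : J₁ᴴ * J₁ = 1)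
    (h₂₁ : J₂ᴴ * J₁ = 0) (hJ : J₁ * J₁ᴴ + J₂ * J₂ᴴ = 1)
    (hV : IsUnit V) (hVd : (A - F * X) * V = V * diagonal d) (hd : ∀ i, (d i).re < 0)
    (ps : List ℂ) (hps : ∀ p ∈ ps, 0 < p.re) {β : ℝ} (hβ0 : 0 ≤ β)
    (hβ : ∀ i, (ps.map fun p => ‖d i + conj p‖ / ‖d i - p‖).prod ≤ β) :
    ∃ E : Matrix ι ι ℂ, ‖E‖ ≤ ‖X‖ * (‖V‖ * ‖V⁻¹‖ * β) ^ 2 ∧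
      (J₂ᴴ * (X + E) * J₁).rank ≤
          ps.length * ((J₂ᴴ * A * J₁).rank + (J₂ᴴ * Aᴴ * J₁).rank +
            (J₂ᴴ * F * J₁).rank + (J₂ᴴ * Q * J₁).rank) := by
  have hne : ∀ p ∈ ps, ∀ i, d i ≠ p := by
    rintro p hp i rfl
    exact absurd (hps _ hp) (not_lt.2 (hd i).le)
  have hun : ∀ p ∈ ps, IsUnit (A - F * X - p • 1) := fun p hp =>
    isUnit_sub_of_diagonalizes hV hVd (hne p hp)
  set T := (ps.map (cayley (A - F * X))).prod with hT
  have hXle : X ≤ (‖X‖ : ℂ) • 1 := by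
    have := IsSelfAdjoint.le_algebraMap_norm_self (a := X) hX.isHermitian
    simpa [Algebra.algebraMap_eq_smul_one] using this
  -- The iteration starts at X + E₀ = ‖X‖·1, which dominates X and has zero off-diagonal blocks.
  obtain ⟨E, hE0, hE, hr⟩ := exists_shifted_error hX.isHermitian hF hcare h₁ h₂₁ hJ ps
    ((‖X‖ : ℂ) • 1 - X) (Matrix.le_iff.1 hXle) (fun p hp => ⟨hps p hp, hun p hp⟩)
  rw [← hT] at hE
  refine ⟨E, ?_, ?_⟩
  · have hTn : ‖T‖ ≤ ‖V‖ * ‖V⁻¹‖ * β := by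
      have hVu := (Matrix.isUnit_iff_isUnit_det _).1 hV
      have e1 : T = V * diagonal (fun i => (ps.map fun p => (d i + conj p) / (d i - p)).prod) *
          V⁻¹ := by
        rw [← prod_cayley_mul_of_diagonalizes hVd ps fun p hp => ⟨hne p hp, hun p hp⟩, mul_assoc,
          Matrix.mul_nonsing_inv _ hVu, mul_one]
      have e2 : ‖(diagonal (fun i => (ps.map fun p => (d i + conj p) / (d i - p)).prod) :
          Matrix ι ι ℂ)‖ ≤ β := by
        rw [l2_opNorm_diagonal]
        refine (pi_norm_le_iff_of_nonneg hβ0).2 fun i => ?_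
        refine le_trans (le_of_eq ?_) (hβ i)
        rw [List.norm_prod, List.map_map]
        congr 2
        funext p
        simp
      rw [e1]
      calc _ ≤ ‖V‖ * ‖_‖ * ‖V⁻¹‖ :=
            (norm_mul_le _ _).trans (mul_le_mul_of_nonneg_right (norm_mul_le _ _) (norm_nonneg _))
        _ ≤ ‖V‖ * β * ‖V⁻¹‖ := by gcongr
        _ = _ := by ring
    have e3 : Tᴴ * ((‖X‖ : ℂ) • 1 - X) * T ≤ (‖X‖ : ℂ) • (Tᴴ * T) := by
      have h := hX.conjTranspose_mul_mul_same T
      have e : Tᴴ * X * T = (‖X‖ : ℂ) • (Tᴴ * T) - Tᴴ * ((‖X‖ : ℂ) • 1 - X) * T := by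
        rw [mul_sub, sub_mul, Matrix.mul_smul, Matrix.smul_mul, mul_one]
        abel
      rw [e] at h
      exact Matrix.le_iff.2 h
    have e4 : ‖E‖ ≤ ‖(‖X‖ : ℂ) • (Tᴴ * T)‖ :=
      CStarAlgebra.norm_le_norm_of_nonneg_of_le hE0 (hE.trans e3)
    calc ‖E‖ ≤ ‖X‖ * (‖T‖ * ‖T‖) := by
          refine e4.trans (le_of_eq ?_)
          rw [norm_smul, l2_opNorm_conjTranspose_mul_self]
          simp
      _ ≤ ‖X‖ * (‖V‖ * ‖V⁻¹‖ * β) ^ 2 := by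
          rw [sq]; gcongr
  · refine hr.trans (le_of_eq ?_)
    rw [add_sub_cancel, Matrix.mul_smul, Matrix.mul_one, Matrix.smul_mul, h₂₁, smul_zero, rank_zero, zero_add]

end Iteration

/-! ### Singular values of a real matrix near a complex matrix of low rank. -/

section SingularValues

open Matrix Module

lemma complexify_mul {p q r : ℕ} (M : Matrix (Fin p) (Fin q) ℝ) (N : Matrix (Fin q) (Fin r) ℝ) :
    complexify (M * N) = complexify M * complexify N :=
  Matrix.map_mul (f := Complex.ofRealHom)

/-- A real rank factorization M = BN, with as many columns in B as the rank of M, is also a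
factorization over ℂ. -/
lemma rank_complexify_le {p q : ℕ} (M : Matrix (Fin p) (Fin q) ℝ) :
    (complexify M).rank ≤ M.rank := by
  let b := Module.finBasis ℝ (LinearMap.range M.mulVecLin)
  have hb : finrank ℝ (LinearMap.range M.mulVecLin) = M.rank := rfl
  let B : Matrix (Fin p) (Fin (finrank ℝ (LinearMap.range M.mulVecLin))) ℝ :=
    Matrix.of fun i k => (b k : Fin p → ℝ) i
  let N : Matrix (Fin (finrank ℝ (LinearMap.range M.mulVecLin))) (Fin q) ℝ :=
    Matrix.of fun k j => b.repr ⟨M *ᵥ Pi.single j 1, ⟨_, rfl⟩⟩ k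
  have h : M = B * N := by
    ext i j
    have h1 := b.sum_repr ⟨M *ᵥ Pi.single j 1, ⟨_, rfl⟩⟩
    have h2 := congrArg (fun v : LinearMap.range M.mulVecLin => (v : Fin p → ℝ) i) h1
    simp only [AddSubmonoidClass.coe_finsetSum, Finset.sum_apply, mulVec_single_one,
      Submodule.coe_smul, Pi.smul_apply, smul_eq_mul, col_apply] at h2
    rw [← h2, Matrix.mul_apply]
    refine Finset.sum_congr rfl fun k _ => ?_
    simp only [B, N, of_apply, mulVec_single_one]
    ring
  calc (complexify M).rank = (complexify B * complexify N).rank := by rw [← complexify_mul, ← h]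
    _ ≤ (complexify B).rank := rank_mul_le_left _ _
    _ ≤ finrank ℝ (LinearMap.range M.mulVecLin) := rank_le_width _

lemma norm_sq_complex_vector {p : ℕ} (u v : Fin p → ℝ) :
    ‖(WithLp.toLp 2 (fun i => (u i : ℂ) + Complex.I * (v i : ℂ)) : EuclideanSpace ℂ (Fin p))‖ ^ 2 =
      ‖(WithLp.toLp 2 u : EuclideanSpace ℝ (Fin p))‖ ^ 2 +
        ‖(WithLp.toLp 2 v : EuclideanSpace ℝ (Fin p))‖ ^ 2 := by
  rw [EuclideanSpace.norm_sq_eq, EuclideanSpace.norm_sq_eq, EuclideanSpace.norm_sq_eq,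
    ← Finset.sum_add_distrib]
  refine Finset.sum_congr rfl fun i _ => ?_
  rw [Complex.sq_norm, Complex.normSq_apply]
  simp
  ring

lemma complexify_mulVec {p q : ℕ} (M : Matrix (Fin p) (Fin q) ℝ) (u v : Fin q → ℝ) :
    complexify M *ᵥ (fun i => (u i : ℂ) + Complex.I * (v i : ℂ)) =
      fun i => ((M *ᵥ u) i : ℂ) + Complex.I * ((M *ᵥ v) i : ℂ) := by
  funext i
  simp only [mulVec, dotProduct, complexify, map_apply, Complex.ofReal_sum, Complex.ofReal_mul,
    Finset.mul_sum, ← Finset.sum_add_distrib]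
  refine Finset.sum_congr rfl fun j _ => ?_
  ring

/-- On the span of the first `r + 1` right singular vectors the map expands by at least the
corresponding singular value. -/
lemma singularValues_mul_norm_le {E F : Type*} [NormedAddCommGroup E] [InnerProductSpace ℝ E]
    [FiniteDimensional ℝ E] [NormedAddCommGroup F] [InnerProductSpace ℝ F] [FiniteDimensional ℝ F]
    (T : E →ₗ[ℝ] F) {n : ℕ} (hn : finrank ℝ E = n) {r : ℕ} (hr : r + 1 ≤ n) (a : Fin (r + 1) → ℝ) :
    T.singularValues r * ‖∑ k, a k • T.isSymmetric_adjoint_comp_self.eigenvectorBasis hn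
        (Fin.castLE hr k)‖ ≤
      ‖T (∑ k, a k • T.isSymmetric_adjoint_comp_self.eigenvectorBasis hn (Fin.castLE hr k))‖ := by
  set b := T.isSymmetric_adjoint_comp_self.eigenvectorBasis hn with hb
  set u := ∑ k, a k • b (Fin.castLE hr k) with hu
  have horth : Orthonormal ℝ (fun k => b (Fin.castLE hr k)) :=
    b.orthonormal.comp _ (Fin.castLE_injective hr)
  have h1 : ‖u‖ ^ 2 = ∑ k, a k ^ 2 := by
    rw [← real_inner_self_eq_norm_sq, hu, horth.inner_sum]
    exact Finset.sum_congr rfl fun k _ => by simp [sq]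
  have h2 : ‖T u‖ ^ 2 = ∑ k : Fin (r + 1), T.singularValues k ^ 2 * a k ^ 2 := by
    have e1 : (LinearMap.adjoint T ∘ₗ T) u =
        ∑ k : Fin (r + 1), (T.singularValues k ^ 2 * a k) • b (Fin.castLE hr k) := by
      rw [hu, map_sum]
      refine Finset.sum_congr rfl fun k _ => ?_
      have := T.isSymmetric_adjoint_comp_self.apply_eigenvectorBasis hn (Fin.castLE hr k)
      rw [map_smul, ← hb] at *
      rw [this, ← T.sq_singularValues_fin hn, smul_smul, mul_comm]
      rfl
    rw [← real_inner_self_eq_norm_sq, ← LinearMap.adjoint_inner_left]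
    change inner ℝ ((LinearMap.adjoint T ∘ₗ T) u) u = _
    rw [e1, hu, horth.inner_sum]
    exact Finset.sum_congr rfl fun k _ => by simp; ring
  refine le_of_sq_le_sq ?_ (norm_nonneg _)
  rw [mul_pow, h1, h2, Finset.mul_sum]
  refine Finset.sum_le_sum fun k _ => ?_
  have : T.singularValues r ≤ T.singularValues k :=
    T.singularValues_antitone (Nat.lt_succ_iff.1 k.2)
  have h0 := T.singularValues_nonneg r
  gcongr

/-- A real matrix at distance at most `c` from a complex matrix of rank at most `r` satisfies
`σ_{r+1} ≤ c`. -/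
theorem sigma_succ_le_of_rank_le {p q r : ℕ} (M : Matrix (Fin p) (Fin q) ℝ)
    {N : Matrix (Fin p) (Fin q) ℂ} (hN : N.rank ≤ r) {c : ℝ} (hc : ‖complexify M - N‖ ≤ c) :
    sigma M (r + 1) ≤ c := by
  have hc0 : 0 ≤ c := (norm_nonneg _).trans hc
  have hn : finrank ℝ (EuclideanSpace ℝ (Fin q)) = q := finrank_euclideanSpace_fin
  set T := Matrix.toEuclideanLin M with hT
  have hs : sigma M (r + 1) = T.singularValues r := rfl
  rw [hs]
  by_cases hr : r + 1 ≤ q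
  swap
  · rw [T.singularValues_of_finrank_le (by omega)]; exact hc0
  set b := T.isSymmetric_adjoint_comp_self.eigenvectorBasis hn with hb
  let Φ : (Fin (r + 1) → ℂ) →ₗ[ℂ] (Fin q → ℂ) :=
    Fintype.linearCombination ℂ (fun k i => ((b (Fin.castLE hr k)).ofLp i : ℂ))
  -- The Eckart–Young argument, over ℂ because complex shifts give a complex approximant: the kernel
  -- of N meets the complex span of the first r + 1 right singular vectors. The real and imaginary
  -- parts `u`, `v` of the vector found lie in the real span, where the expansion bound applies to
  -- each.
  obtain ⟨z, hz, hz0⟩ : ∃ z : Fin (r + 1) → ℂ, (N.mulVecLin ∘ₗ Φ) z = 0 ∧ z ≠ 0 := by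
    by_contra! hcon
    have hinj : Function.Injective (N.mulVecLin ∘ₗ Φ) :=
      (injective_iff_map_eq_zero _).2 hcon
    have h1 := LinearMap.finrank_range_of_inj hinj
    have h2 := finrank_range_mulVecLin_comp_le N Φ
    rw [Module.finrank_fintype_fun_eq_card, Fintype.card_fin] at h1
    omega
  set u : EuclideanSpace ℝ (Fin q) := ∑ k, (z k).re • b (Fin.castLE hr k) with hu
  set v : EuclideanSpace ℝ (Fin q) := ∑ k, (z k).im • b (Fin.castLE hr k) with hv
  have hΦ : Φ z = fun i => (u.ofLp i : ℂ) + Complex.I * (v.ofLp i : ℂ) := by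
    funext i
    simp only [Φ, Fintype.linearCombination_apply, hu, hv, WithLp.ofLp_sum, Finset.sum_apply,
      WithLp.ofLp_smul, Pi.smul_apply, smul_eq_mul, Complex.ofReal_sum, Complex.ofReal_mul,
      Finset.mul_sum, ← Finset.sum_add_distrib]
    refine Finset.sum_congr rfl fun k _ => ?_
    conv_lhs => rw [← Complex.re_add_im (z k)]
    ring
  have hu1 : T.singularValues r * ‖u‖ ≤ ‖T u‖ :=
    singularValues_mul_norm_le T hn hr (fun k => (z k).re)
  have hv1 : T.singularValues r * ‖v‖ ≤ ‖T v‖ :=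
    singularValues_mul_norm_le T hn hr (fun k => (z k).im)
  set w : EuclideanSpace ℂ (Fin q) := WithLp.toLp 2 (Φ z) with hw
  have hwn : ‖w‖ ^ 2 = ‖u‖ ^ 2 + ‖v‖ ^ 2 := by
    rw [hw, hΦ, norm_sq_complex_vector]
  have hMw : ‖(WithLp.toLp 2 ((complexify M - N) *ᵥ w.ofLp) : EuclideanSpace ℂ (Fin p))‖ ^ 2 =
      ‖T u‖ ^ 2 + ‖T v‖ ^ 2 := by
    have hz' : N *ᵥ Φ z = 0 := hz
    rw [hw, sub_mulVec, hz', sub_zero, hΦ, complexify_mulVec, norm_sq_complex_vector]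
    rfl
  have hw0 : 0 < ‖w‖ ^ 2 := by
    have horth : Orthonormal ℝ (fun k => b (Fin.castLE hr k)) :=
      b.orthonormal.comp _ (Fin.castLE_injective hr)
    have h1 : ∀ a : Fin (r + 1) → ℝ, ‖∑ k, a k • b (Fin.castLE hr k)‖ ^ 2 = ∑ k, a k ^ 2 := by
      intro a
      rw [← real_inner_self_eq_norm_sq, horth.inner_sum]
      exact Finset.sum_congr rfl fun k _ => by simp [sq]
    obtain ⟨k, hk⟩ := Function.ne_iff.1 hz0
    rw [hwn, h1 (fun k => (z k).re), h1 (fun k => (z k).im), ← Finset.sum_add_distrib]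
    refine Finset.sum_pos' (fun i _ => by positivity) ⟨k, Finset.mem_univ _, ?_⟩
    have := Complex.normSq_pos.2 hk
    rw [Complex.normSq_apply] at this
    nlinarith
  have hup : ‖(WithLp.toLp 2 ((complexify M - N) *ᵥ w.ofLp) : EuclideanSpace ℂ (Fin p))‖ ≤
      c * ‖w‖ :=
    (l2_opNorm_mulVec _ w).trans (mul_le_mul_of_nonneg_right hc (norm_nonneg _))
  have h0 := T.singularValues_nonneg r
  have hsq : (T.singularValues r) ^ 2 * ‖w‖ ^ 2 ≤ c ^ 2 * ‖w‖ ^ 2 := by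
    calc (T.singularValues r) ^ 2 * ‖w‖ ^ 2
        = (T.singularValues r * ‖u‖) ^ 2 + (T.singularValues r * ‖v‖) ^ 2 := by rw [hwn]; ring
      _ ≤ ‖T u‖ ^ 2 + ‖T v‖ ^ 2 := by gcongr
      _ ≤ (c * ‖w‖) ^ 2 := by rw [← hMw]; gcongr
      _ = _ := by ring
  exact le_of_sq_le_sq (le_of_mul_le_mul_right hsq hw0) hc0

end SingularValues

/-! ### Submatrices as products with coordinate inclusions. -/

section Blocks

open Matrix

/-- The matrix of the inclusion of the coordinates selected by `e`. -/
def inclusionMatrix {k n : ℕ} (e : Fin k → Fin n) : Matrix (Fin n) (Fin k) ℂ :=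
  (1 : Matrix (Fin n) (Fin n) ℂ).submatrix id e

lemma conjTranspose_inclusionMatrix_mul_mul {k l n : ℕ} (e : Fin k → Fin n) (f : Fin l → Fin n)
    (M : Matrix (Fin n) (Fin n) ℂ) :
    (inclusionMatrix f)ᴴ * M * inclusionMatrix e = M.submatrix f e := by
  ext i j
  simp [inclusionMatrix, Matrix.mul_apply, Matrix.one_apply]

lemma conjTranspose_inclusionMatrix_mul {k l n : ℕ} (e : Fin k → Fin n) (f : Fin l → Fin n) :
    (inclusionMatrix f)ᴴ * inclusionMatrix e =
      (1 : Matrix (Fin n) (Fin n) ℂ).submatrix f e := by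
  rw [← conjTranspose_inclusionMatrix_mul_mul, Matrix.mul_one]

lemma norm_inclusionMatrix_le {k n : ℕ} {e : Fin k → Fin n} (he : Function.Injective e) :
    ‖inclusionMatrix e‖ ≤ 1 := by
  have h1 : ‖inclusionMatrix e‖ * ‖inclusionMatrix e‖ ≤ 1 := by
    rw [← l2_opNorm_conjTranspose_mul_self, conjTranspose_inclusionMatrix_mul,
      Matrix.submatrix_one e he, ← Matrix.diagonal_one, l2_opNorm_diagonal]
    exact (pi_norm_le_iff_of_nonneg zero_le_one).2 fun i => by simp
  nlinarith [norm_nonneg (inclusionMatrix e)]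

lemma inclusionMatrix_mul_add_mul {k l n : ℕ} {e : Fin k → Fin n} {f : Fin l → Fin n}
    (h : Function.Bijective (Sum.elim e f)) :
    inclusionMatrix e * (inclusionMatrix e)ᴴ + inclusionMatrix f * (inclusionMatrix f)ᴴ = 1 := by
  ext i j
  have h1 : (inclusionMatrix e * (inclusionMatrix e)ᴴ +
      inclusionMatrix f * (inclusionMatrix f)ᴴ) i j =
      ∑ x : Fin k ⊕ Fin l, (1 : Matrix (Fin n) (Fin n) ℂ) i (Sum.elim e f x) *
        star ((1 : Matrix (Fin n) (Fin n) ℂ) j (Sum.elim e f x)) := by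
    rw [Fintype.sum_sum_type]
    rfl
  rw [h1, h.sum_comp (fun y => (1 : Matrix (Fin n) (Fin n) ℂ) i y *
    star ((1 : Matrix (Fin n) (Fin n) ℂ) j y))]
  simp [Matrix.one_apply]

lemma bijective_elim_firstIdx_lastIdx {s n : ℕ} (hs : s ≤ n) :
    Function.Bijective (Sum.elim (firstIdx hs) (lastIdx (Nat.sub_le n s))) := by
  constructor
  · rintro (a | a) (b | b) h <;>
      simp only [Sum.elim_inl, Sum.elim_inr, firstIdx, lastIdx, Fin.ext_iff, Fin.val_castLE] at h <;>
      simp only [Sum.inl.injEq, Sum.inr.injEq, reduceCtorEq, Fin.ext_iff] <;> omega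
  · intro x
    by_cases hx : x.1 < s
    · exact ⟨Sum.inl ⟨x, hx⟩, rfl⟩
    · refine ⟨Sum.inr ⟨x - s, by omega⟩, ?_⟩
      simp only [Sum.elim_inr, lastIdx, Fin.ext_iff]
      omega

end Blocks

/-! ### Location of closed-loop eigenvalues and uniqueness of the solution. -/

section EigenvalueBounds

open Matrix
open scoped ComplexConjugate ComplexOrder MatrixOrder

variable {ι κ : Type*} [Fintype ι] [Fintype κ]

lemma star_dotProduct_self_eq (x : ι → ℂ) :
    star x ⬝ᵥ x = ((‖(WithLp.toLp 2 x : EuclideanSpace ℂ ι)‖ ^ 2 : ℝ) : ℂ) := by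
  rw [EuclideanSpace.norm_sq_eq, dotProduct, Complex.ofReal_sum]
  refine Finset.sum_congr rfl fun i _ => ?_
  rw [Pi.star_apply, RCLike.star_def, mul_comm, Complex.mul_conj, Complex.normSq_eq_norm_sq]

lemma norm_star_dotProduct_le (x y : ι → ℂ) :
    ‖star x ⬝ᵥ y‖ ≤ ‖(WithLp.toLp 2 x : EuclideanSpace ℂ ι)‖ *
      ‖(WithLp.toLp 2 y : EuclideanSpace ℂ ι)‖ := by
  have := norm_inner_le_norm (𝕜 := ℂ) (WithLp.toLp 2 x : EuclideanSpace ℂ ι) (WithLp.toLp 2 y)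
  rwa [EuclideanSpace.inner_toLp_toLp, dotProduct_comm] at this

lemma star_dotProduct_conjTranspose_mul (M N : Matrix κ ι ℂ) (x y : ι → ℂ) :
    star x ⬝ᵥ ((Mᴴ * N) *ᵥ y) = star (M *ᵥ x) ⬝ᵥ (N *ᵥ y) := by
  rw [← mulVec_mulVec, dotProduct_mulVec, star_mulVec]

variable [DecidableEq ι]

lemma norm_toLp_mulVec_le {M : Matrix κ ι ℂ} {c : ℝ} (h : ‖M‖ ≤ c) (x : ι → ℂ) :
    ‖(WithLp.toLp 2 (M *ᵥ x) : EuclideanSpace ℂ κ)‖ ≤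
      c * ‖(WithLp.toLp 2 x : EuclideanSpace ℂ ι)‖ :=
  (l2_opNorm_mulVec M (WithLp.toLp 2 x)).trans (mul_le_mul_of_nonneg_right h (norm_nonneg _))

lemma exists_eq_conjTranspose_mul_self {𝕜 : Type*} [RCLike 𝕜] {M : Matrix ι ι 𝕜}
    (hM : M.PosSemidef) : ∃ B : Matrix ι ι 𝕜, M = Bᴴ * B :=
  CStarAlgebra.nonneg_iff_eq_star_mul_self.1 hM.nonneg

/-- The eigenvalues of a closed-loop matrix stay away from the imaginary axis and from infinity. -/
theorem closedLoop_eigenvalue_bounds {A F Q X : Matrix ι ι ℂ} (hF : F.PosDef)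
    (hX : X.IsHermitian) (hcare : Aᴴ * X + X * A - X * F * X + Q = 0)
    {a φ ψ q₀ q₁ : ℝ} (ha : ‖A‖ ≤ a) (hφ : ‖F‖ ≤ φ) (hψ : ‖F⁻¹‖ ≤ ψ)
    (hQ₀ : (Q - (q₀ : ℂ) • 1).PosSemidef) (hQ₁ : ‖Q‖ ≤ q₁)
    {z : ℂ} {v : ι → ℂ} (hv : v ≠ 0) (hz : (A - F * X) *ᵥ v = z • v) :
    q₀ ≤ ψ * z.re ^ 2 ∧ ‖z‖ ^ 2 ≤ φ * ψ * a ^ 2 + φ * q₁ := by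
  obtain ⟨B, hB⟩ := exists_eq_conjTranspose_mul_self hF.posSemidef
  have hBu : IsUnit B := by
    have := hF.isUnit
    rw [hB, isUnit_iff_isUnit_det, det_mul] at this
    exact (isUnit_iff_isUnit_det _).2 (isUnit_of_mul_isUnit_right this)
  have hBd := (isUnit_iff_isUnit_det _).1 hBu
  have hFd := (isUnit_iff_isUnit_det _).1 hF.isUnit
  -- S plays the role of F^{-1/2}: only SᴴS = F⁻¹ matters, so the factor B need not be Hermitian.
  set S := (B⁻¹)ᴴ with hS
  have hSF : Sᴴ * S = F⁻¹ := by
    rw [hS, conjTranspose_conjTranspose, hB, Matrix.mul_inv_rev, conjTranspose_nonsing_inv]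
  have hBS : Bᴴ * S = 1 := by
    rw [hS, ← conjTranspose_mul, nonsing_inv_mul _ hBd, conjTranspose_one]
  have hFi : F⁻¹ * F = 1 := nonsing_inv_mul _ hFd
  have hFi' : F * F⁻¹ = 1 := mul_nonsing_inv _ hFd
  have hnS : ‖S‖ * ‖S‖ ≤ ψ := by rwa [← l2_opNorm_conjTranspose_mul_self, hSF]
  have hnB : ‖Bᴴ‖ * ‖Bᴴ‖ ≤ φ := by
    rwa [l2_opNorm_conjTranspose, ← l2_opNorm_conjTranspose_mul_self, ← hB]
  have hφ0 : 0 ≤ φ := (norm_nonneg _).trans hφ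
  have hψ0 : 0 ≤ ψ := (norm_nonneg _).trans hψ
  have ha0 : 0 ≤ a := (norm_nonneg _).trans ha
  set nv := ‖(WithLp.toLp 2 v : EuclideanSpace ℂ ι)‖ with hnv
  set s := ‖(WithLp.toLp 2 (S *ᵥ v) : EuclideanSpace ℂ ι)‖ with hs
  set α := ‖(WithLp.toLp 2 (S *ᵥ (A *ᵥ v)) : EuclideanSpace ℂ ι)‖ with hα
  have hnv0 : 0 < nv := by
    rw [hnv, norm_pos_iff]
    intro h
    exact hv (congrArg WithLp.ofLp h)
  have hs1 : s ^ 2 ≤ ψ * nv ^ 2 := by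
    have := norm_toLp_mulVec_le (le_refl ‖S‖) v
    calc s ^ 2 ≤ (‖S‖ * nv) ^ 2 := by gcongr
      _ = ‖S‖ * ‖S‖ * nv ^ 2 := by ring
      _ ≤ _ := by gcongr
  have hs2 : nv ^ 2 ≤ φ * s ^ 2 := by
    have := norm_toLp_mulVec_le (le_refl ‖Bᴴ‖) (S *ᵥ v)
    rw [mulVec_mulVec, hBS, one_mulVec] at this
    calc nv ^ 2 ≤ (‖Bᴴ‖ * s) ^ 2 := by gcongr
      _ = ‖Bᴴ‖ * ‖Bᴴ‖ * s ^ 2 := by ring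
      _ ≤ _ := by gcongr
  have hα1 : α ^ 2 ≤ ψ * a ^ 2 * nv ^ 2 := by
    have h1 := norm_toLp_mulVec_le (le_refl ‖S‖) (A *ᵥ v)
    have h2 := norm_toLp_mulVec_le ha v
    calc α ^ 2 ≤ (‖S‖ * (a * nv)) ^ 2 := by
          gcongr
          exact h1.trans (mul_le_mul_of_nonneg_left h2 (norm_nonneg _))
      _ = ‖S‖ * ‖S‖ * (a ^ 2 * nv ^ 2) := by ring
      _ ≤ ψ * (a ^ 2 * nv ^ 2) := by gcongr
      _ = _ := by ring
  have hs0 : 0 < s ^ 2 := by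
    by_contra! h
    nlinarith [pow_pos hnv0 2]
  -- the quadratic form of `Q`
  set q := (star v ⬝ᵥ (Q *ᵥ v)).re with hq
  have hq0 : q₀ * nv ^ 2 ≤ q := by
    have := (RCLike.nonneg_iff.1 (hQ₀.dotProduct_mulVec_nonneg v)).1
    rw [sub_mulVec, smul_mulVec, one_mulVec, dotProduct_sub, dotProduct_smul,
      star_dotProduct_self_eq, smul_eq_mul, ← Complex.ofReal_mul] at this
    change 0 ≤ (_ - _ : ℂ).re at this
    rw [Complex.sub_re, Complex.ofReal_re] at this
    linarith
  have hq1 : q ≤ q₁ * nv ^ 2 := by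
    calc q ≤ ‖star v ⬝ᵥ (Q *ᵥ v)‖ := Complex.re_le_norm _
      _ ≤ nv * (q₁ * nv) := (norm_star_dotProduct_le _ _).trans
          (mul_le_mul_of_nonneg_left (norm_toLp_mulVec_le hQ₁ v) (norm_nonneg _))
      _ = _ := by ring
  -- the two eigenvalue identities
  have hgram : (S * (A - F * X))ᴴ * (S * (A - F * X)) = (S * A)ᴴ * (S * A) + Q := by
    have e1 : (S * (A - F * X))ᴴ * (S * (A - F * X)) =
        (A - F * X)ᴴ * F⁻¹ * (A - F * X) := by
      rw [conjTranspose_mul, ← hSF]; noncomm_ring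
    have e2 : (S * A)ᴴ * (S * A) = Aᴴ * F⁻¹ * A := by
      rw [conjTranspose_mul, ← hSF]; noncomm_ring
    have e3 : (A - F * X)ᴴ = Aᴴ - X * F := by
      rw [conjTranspose_sub, conjTranspose_mul, hX.eq, hF.isHermitian.eq]
    have e4 : (Aᴴ - X * F) * F⁻¹ * (A - F * X) = Aᴴ * F⁻¹ * A - Aᴴ * (F⁻¹ * F) * X -
        X * (F * F⁻¹) * A + X * (F * F⁻¹) * F * X := by noncomm_ring
    rw [e1, e2, e3, e4, hFi, hFi', mul_one, mul_one, ← sub_eq_zero, ← neg_eq_zero, ← hcare]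
    abel
  have hnorm : ‖z‖ ^ 2 * s ^ 2 = α ^ 2 + q := by
    have h := congrArg (fun M => star v ⬝ᵥ (M *ᵥ v)) hgram
    simp only [add_mulVec, dotProduct_add, star_dotProduct_conjTranspose_mul] at h
    rw [← mulVec_mulVec, ← mulVec_mulVec, hz, mulVec_smul, star_dotProduct_self_eq,
      star_dotProduct_self_eq, WithLp.toLp_smul, norm_smul] at h
    have := congrArg Complex.re h
    rw [Complex.add_re, Complex.ofReal_re, Complex.ofReal_re, mul_pow] at this
    exact this
  -- In F⁻¹(A - FX) = F⁻¹A - X the Hermitian term X has a real quadratic form, so the imaginary part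
  -- of z is controlled by A alone. Subtracting this from `hnorm` leaves the contribution of Q to
  -- the real part.
  have him : z.im ^ 2 * s ^ 2 ≤ α ^ 2 := by
    have e : Sᴴ * (S * (A - F * X)) = Sᴴ * (S * A) - X := by
      rw [← mul_assoc, ← mul_assoc, hSF, mul_sub, ← mul_assoc F⁻¹ F, hFi, one_mul]
    have h := congrArg (fun M => star v ⬝ᵥ (M *ᵥ v)) e
    simp only [sub_mulVec, dotProduct_sub, star_dotProduct_conjTranspose_mul] at h
    rw [← mulVec_mulVec, ← mulVec_mulVec, hz, mulVec_smul, dotProduct_smul,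
      star_dotProduct_self_eq, smul_eq_mul] at h
    have hx : (star v ⬝ᵥ (X *ᵥ v)).im = 0 := hX.im_star_dotProduct_mulVec_self v
    have h' := congrArg Complex.im h
    rw [Complex.sub_im, hx, sub_zero, Complex.mul_im, Complex.ofReal_re, Complex.ofReal_im,
      mul_zero, zero_add] at h'
    have h1 : |z.im * s ^ 2| ≤ s * α := by
      rw [h']
      exact (Complex.abs_im_le_norm _).trans (norm_star_dotProduct_le _ _)
    have h2 := sq_le_sq' (by linarith [abs_le.1 h1]) (abs_le.1 h1).2
    have h3 : s ^ 2 * (z.im ^ 2 * s ^ 2) ≤ s ^ 2 * α ^ 2 := by linarith [h2]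
    exact le_of_mul_le_mul_left h3 hs0
  have hz2 : ‖z‖ ^ 2 = z.re ^ 2 + z.im ^ 2 := by
    rw [Complex.sq_norm, Complex.normSq_apply]; ring
  constructor
  · have h1 : q ≤ z.re ^ 2 * s ^ 2 := by
      rw [hz2] at hnorm; linarith
    have h2 : q₀ * nv ^ 2 ≤ ψ * z.re ^ 2 * nv ^ 2 := by
      calc q₀ * nv ^ 2 ≤ z.re ^ 2 * s ^ 2 := hq0.trans h1
        _ ≤ z.re ^ 2 * (ψ * nv ^ 2) := by gcongr
        _ = _ := by ring
    exact le_of_mul_le_mul_right h2 (pow_pos hnv0 2)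
  · have hq₁ : 0 ≤ q₁ := (norm_nonneg _).trans hQ₁
    refine le_of_mul_le_mul_right ?_ hs0
    calc ‖z‖ ^ 2 * s ^ 2 ≤ (ψ * a ^ 2 + q₁) * nv ^ 2 := by rw [hnorm]; linarith
      _ ≤ (ψ * a ^ 2 + q₁) * (φ * s ^ 2) := by gcongr
      _ = _ := by ring

lemma exists_eigenvector_of_mem_spectrum {M : Matrix ι ι ℂ} {z : ℂ} (h : z ∈ spectrum ℂ M) :
    ∃ v : ι → ℂ, v ≠ 0 ∧ M *ᵥ v = z • v := by
  rw [spectrum.mem_iff, isUnit_iff_isUnit_det, isUnit_iff_ne_zero, not_not,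
    ← exists_mulVec_eq_zero_iff] at h
  obtain ⟨v, hv, h⟩ := h
  refine ⟨v, hv, ?_⟩
  rw [sub_mulVec, Algebra.algebraMap_eq_smul_one, smul_mulVec, one_mulVec, sub_eq_zero] at h
  exact h.symm

/-- Two solutions of the Riccati equation with stable closed-loop matrices agree. -/
lemma eq_of_stable_of_diagonalizes {A F Q X Y V : Matrix ι ι ℂ} {d : ι → ℂ}
    (hX : X.IsHermitian) (hF : F.IsHermitian)
    (hcX : Aᴴ * X + X * A - X * F * X + Q = 0) (hcY : Aᴴ * Y + Y * A - Y * F * Y + Q = 0)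
    (hsX : ∀ z ∈ spectrum ℂ (A - F * X), z.re < 0)
    (hV : IsUnit V) (hVd : (A - F * Y) * V = V * diagonal d) (hd : ∀ i, (d i).re < 0) :
    X = Y := by
  -- The difference of the two Riccati equations is a homogeneous Sylvester equation in X - Y with
  -- stable coefficients.
  have hsyl : (A - F * X)ᴴ * (X - Y) + (X - Y) * (A - F * Y) = 0 := by
    rw [conjTranspose_sub, conjTranspose_mul, hX.eq, hF.eq]
    have : (Aᴴ - X * F) * (X - Y) + (X - Y) * (A - F * Y) =
        (Aᴴ * X + X * A - X * F * X + Q) - (Aᴴ * Y + Y * A - Y * F * Y + Q) := by noncomm_ring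
    rw [this, hcX, hcY, sub_zero]
  have hDV : (A - F * X)ᴴ * ((X - Y) * V) + (X - Y) * V * diagonal d = 0 := by
    rw [mul_assoc (X - Y) V, ← hVd, ← mul_assoc, ← mul_assoc, ← add_mul, hsyl, zero_mul]
  -- A nonzero column of (X - Y)V would be an eigenvector of (A - FX)ᴴ for -dᵢ, which has positive
  -- real part.
  have hcol : ∀ i, ((X - Y) * V) *ᵥ Pi.single i 1 = 0 := by
    intro i
    have h := congrArg (fun M => M *ᵥ (Pi.single i 1 : ι → ℂ)) hDV
    have hdiag : diagonal d *ᵥ (Pi.single i 1 : ι → ℂ) = d i • Pi.single i 1 := by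
      rw [diagonal_mulVec_single, mul_one, ← Pi.single_smul, smul_eq_mul, mul_one]
    simp only [add_mulVec, zero_mulVec] at h
    rw [← mulVec_mulVec, ← mulVec_mulVec _ _ (diagonal d), hdiag, mulVec_smul] at h
    set w := ((X - Y) * V) *ᵥ (Pi.single i 1 : ι → ℂ)
    by_contra hw
    have hmem : -d i ∈ spectrum ℂ ((A - F * X)ᴴ) := by
      rw [spectrum.mem_iff, isUnit_iff_isUnit_det, isUnit_iff_ne_zero, not_not,
        ← exists_mulVec_eq_zero_iff]
      refine ⟨w, hw, ?_⟩
      rw [sub_mulVec, Algebra.algebraMap_eq_smul_one, smul_mulVec, one_mulVec, neg_smul,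
        ← neg_eq_zero, ← h]
      abel
    rw [← star_eq_conjTranspose, spectrum.map_star, Set.mem_star] at hmem
    have := hsX _ hmem
    simp at this
    linarith [hd i]
  have hzero : (X - Y) * V = 0 := by
    ext i j
    have := congrFun (hcol j) i
    rwa [mulVec_single_one] at this
  have hVd' := (isUnit_iff_isUnit_det _).1 hV
  rw [← sub_eq_zero, ← mul_one (X - Y), ← mul_nonsing_inv _ hVd', ← mul_assoc, hzero, zero_mul]

end EigenvalueBounds

/-! ### Passage from ℝ to ℂ, and norms of principal submatrices. -/

section Complexification

open Matrix
open scoped ComplexOrder MatrixOrder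

lemma conjTranspose_complexify {p q : ℕ} (M : Matrix (Fin p) (Fin q) ℝ) :
    (complexify M)ᴴ = complexify Mᵀ := by
  ext i j
  simp [complexify]

lemma complexify_one {p : ℕ} : complexify (1 : Matrix (Fin p) (Fin p) ℝ) = 1 :=
  Matrix.map_one _ Complex.ofReal_zero Complex.ofReal_one

lemma complexify_sub {p q : ℕ} (M N : Matrix (Fin p) (Fin q) ℝ) :
    complexify (M - N) = complexify M - complexify N := by
  ext i j
  simp [complexify]

lemma complexify_add {p q : ℕ} (M N : Matrix (Fin p) (Fin q) ℝ) :
    complexify (M + N) = complexify M + complexify N := by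
  ext i j
  simp [complexify]

lemma complexify_smul {p q : ℕ} (c : ℝ) (M : Matrix (Fin p) (Fin q) ℝ) :
    complexify (c • M) = (c : ℂ) • complexify M := by
  ext i j
  simp [complexify]

lemma complexify_inv {p : ℕ} {M : Matrix (Fin p) (Fin p) ℝ} (hM : IsUnit M) :
    (complexify M)⁻¹ = complexify M⁻¹ := by
  refine inv_eq_left_inv ?_
  rw [← complexify_mul, nonsing_inv_mul _ ((isUnit_iff_isUnit_det _).1 hM), complexify_one]

lemma isUnit_complexify {p : ℕ} {M : Matrix (Fin p) (Fin p) ℝ} (hM : IsUnit M) :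
    IsUnit (complexify M) :=
  hM.map (Complex.ofRealHom.mapMatrix (m := Fin p))

lemma complexify_posSemidef {p : ℕ} {M : Matrix (Fin p) (Fin p) ℝ} (hM : M.PosSemidef) :
    (complexify M).PosSemidef := by
  obtain ⟨B, rfl⟩ := exists_eq_conjTranspose_mul_self hM
  rw [complexify_mul, conjTranspose_eq_transpose_of_trivial, ← conjTranspose_complexify]
  exact posSemidef_conjTranspose_mul_self _

lemma complexify_posDef {p : ℕ} {M : Matrix (Fin p) (Fin p) ℝ} (hM : M.PosDef) :
    (complexify M).PosDef :=
  (complexify_posSemidef hM.posSemidef).posDef_iff_isUnit.2 (isUnit_complexify hM.isUnit)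

lemma norm_le_of_forall_mulVec {ι κ : Type*} [Fintype ι] [Fintype κ] [DecidableEq ι]
    {M : Matrix κ ι ℂ} {c : ℝ} (hc : 0 ≤ c)
    (h : ∀ x : ι → ℂ, ‖(WithLp.toLp 2 (M *ᵥ x) : EuclideanSpace ℂ κ)‖ ≤
      c * ‖(WithLp.toLp 2 x : EuclideanSpace ℂ ι)‖) : ‖M‖ ≤ c := by
  rw [l2_opNorm_def]
  exact ContinuousLinearMap.opNorm_le_bound _ hc fun x => h x.ofLp

lemma norm_complexify_le {p q : ℕ} (M : Matrix (Fin p) (Fin q) ℝ) : ‖complexify M‖ ≤ ‖M‖ := by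
  refine norm_le_of_forall_mulVec (norm_nonneg _) fun x => le_of_sq_le_sq ?_ (by positivity)
  have hx : x = fun i => ((x i).re : ℂ) + Complex.I * ((x i).im : ℂ) := by
    funext i
    rw [mul_comm, Complex.re_add_im]
  rw [hx, complexify_mulVec, mul_pow, norm_sq_complex_vector, norm_sq_complex_vector, mul_add,
    ← mul_pow, ← mul_pow]
  have h1 := l2_opNorm_mulVec M (WithLp.toLp 2 fun i => (x i).re)
  have h2 := l2_opNorm_mulVec M (WithLp.toLp 2 fun i => (x i).im)
  gcongr
  · exact h1
  · exact h2

lemma norm_conjTranspose_mul_mul_le {ι κ κ' : Type*} [Fintype ι] [Fintype κ] [Fintype κ']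
    [DecidableEq ι] [DecidableEq κ] [DecidableEq κ'] (M : Matrix ι ι ℂ)
    {J : Matrix ι κ ℂ} {K : Matrix ι κ' ℂ} (hJ : ‖J‖ ≤ 1) (hK : ‖K‖ ≤ 1) :
    ‖Kᴴ * M * J‖ ≤ ‖M‖ := by
  calc ‖Kᴴ * M * J‖ ≤ ‖Kᴴ‖ * ‖M‖ * ‖J‖ :=
        (l2_opNorm_mul _ _).trans (mul_le_mul_of_nonneg_right (l2_opNorm_mul _ _) (norm_nonneg _))
    _ ≤ 1 * ‖M‖ * 1 := by rw [l2_opNorm_conjTranspose]; gcongr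
    _ = ‖M‖ := by ring

lemma norm_submatrix_le {j n : ℕ} {e : Fin j → Fin n} (he : Function.Injective e)
    (M : Matrix (Fin n) (Fin n) ℂ) : ‖M.submatrix e e‖ ≤ ‖M‖ := by
  rw [← conjTranspose_inclusionMatrix_mul_mul]
  exact norm_conjTranspose_mul_mul_le M (norm_inclusionMatrix_le he) (norm_inclusionMatrix_le he)

lemma le_mul_of_sq_le_mul {b f x y t : ℝ} (hx : 0 ≤ x) (ht : 0 ≤ t) (hb : b * b = f)
    (hy : y ^ 2 ≤ x * t) (hxy : x ≤ b * y) : x ≤ f * t := by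
  have hf : 0 ≤ f := hb ▸ mul_self_nonneg b
  rcases hx.eq_or_lt with h0 | h0
  · rw [← h0]; positivity
  · refine le_of_mul_le_mul_right ?_ h0
    calc x * x ≤ (b * y) * (b * y) := mul_self_le_mul_self hx hxy
      _ = f * y ^ 2 := by rw [← hb]; ring
      _ ≤ f * (x * t) := by gcongr
      _ = _ := by ring

/-- With F = BᴴB and w the inverse of the submatrix JᴴFJ applied to u, one has ‖BJw‖² = wᴴu ≤ ‖w‖‖u‖
and ‖w‖ ≤ ‖B⁻¹‖‖BJw‖, where ‖B⁻¹‖² = ‖F⁻¹‖. -/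
lemma norm_inv_submatrix_le {j n : ℕ} {e : Fin j → Fin n} (he : Function.Injective e)
    {F : Matrix (Fin n) (Fin n) ℂ} (hF : F.PosDef) : ‖(F.submatrix e e)⁻¹‖ ≤ ‖F⁻¹‖ := by
  obtain ⟨B, hB⟩ := exists_eq_conjTranspose_mul_self hF.posSemidef
  have hBd : IsUnit B.det := by
    have := (isUnit_iff_isUnit_det _).1 hF.isUnit
    rw [hB, det_mul] at this
    exact isUnit_of_mul_isUnit_right this
  have hFs := (isUnit_iff_isUnit_det _).1 (hF.submatrix he).isUnit
  have hnB : ‖(B⁻¹)ᴴ‖ * ‖(B⁻¹)ᴴ‖ = ‖F⁻¹‖ := by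
    rw [← l2_opNorm_conjTranspose_mul_self, conjTranspose_conjTranspose, hB, Matrix.mul_inv_rev,
      conjTranspose_nonsing_inv]
  rw [l2_opNorm_conjTranspose] at hnB
  set J := inclusionMatrix e
  have hJJ : Jᴴ * J = 1 := by
    rw [conjTranspose_inclusionMatrix_mul, submatrix_one e he]
  refine norm_le_of_forall_mulVec (norm_nonneg _) fun u => ?_
  set w := (F.submatrix e e)⁻¹ *ᵥ u with hw
  have hFw : ((B * J)ᴴ * (B * J)) *ᵥ w = u := by
    have : (B * J)ᴴ * (B * J) = F.submatrix e e := by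
      rw [← conjTranspose_inclusionMatrix_mul_mul, hB, conjTranspose_mul]
      simp only [Matrix.mul_assoc, J]
    rw [this, hw, mulVec_mulVec, mul_nonsing_inv _ hFs, one_mulVec]
  have h1 := star_dotProduct_conjTranspose_mul (B * J) (B * J) w w
  rw [hFw, star_dotProduct_self_eq] at h1
  have h2 := norm_star_dotProduct_le w u
  rw [h1, Complex.norm_real, Real.norm_of_nonneg (by positivity)] at h2
  have h3 : ‖(WithLp.toLp 2 w : EuclideanSpace ℂ _)‖ ≤
      ‖B⁻¹‖ * ‖(WithLp.toLp 2 ((B * J) *ᵥ w) : EuclideanSpace ℂ _)‖ := by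
    have e1 : Jᴴ * B⁻¹ * (B * J) = 1 := by
      rw [Matrix.mul_assoc, ← Matrix.mul_assoc B⁻¹, nonsing_inv_mul _ hBd, Matrix.one_mul, hJJ]
    have e2 : ‖Jᴴ * B⁻¹‖ ≤ ‖B⁻¹‖ := by
      calc ‖Jᴴ * B⁻¹‖ ≤ ‖Jᴴ‖ * ‖B⁻¹‖ := l2_opNorm_mul _ _
        _ ≤ 1 * ‖B⁻¹‖ := by
          rw [l2_opNorm_conjTranspose]
          gcongr
          exact norm_inclusionMatrix_le he
        _ = _ := one_mul _
    have := norm_toLp_mulVec_le e2 ((B * J) *ᵥ w)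
    rwa [mulVec_mulVec, e1, one_mulVec] at this
  exact le_mul_of_sq_le_mul (norm_nonneg _) (norm_nonneg _) hnB h2 h3

end Complexification

/-! ### Eigenvalue bounds for the principal subproblems, uniform in their order. -/

section SubproblemBounds

open Matrix
open scoped ComplexOrder MatrixOrder

lemma sub_lambdaMin_posSemidef {n : ℕ} {Q : Matrix (Fin n) (Fin n) ℝ} (hQ : Q.IsHermitian) :
    (Q - lambdaMin Q • 1).PosSemidef := by
  have h : algebraMap ℝ (Matrix (Fin n) (Fin n) ℝ) (lambdaMin Q) ≤ Q :=
    (algebraMap_le_iff_le_spectrum (a := Q) hQ.isSelfAdjoint).2 fun x hx =>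
      csInf_le Q.finite_real_spectrum.bddBelow hx
  rwa [Algebra.algebraMap_eq_smul_one, Matrix.le_iff] at h

lemma lambdaMin_pos {n : ℕ} (hn : 1 ≤ n) {Q : Matrix (Fin n) (Fin n) ℝ} (hQ : Q.PosDef) :
    0 < lambdaMin Q := by
  have : Nonempty (Fin n) := ⟨⟨0, hn⟩⟩
  have hne : (spectrum ℝ Q).Nonempty := by
    rw [hQ.isHermitian.spectrum_real_eq_range_eigenvalues]
    exact Set.range_nonempty _
  have hmem := hne.csInf_mem Q.finite_real_spectrum
  rw [hQ.isHermitian.spectrum_real_eq_range_eigenvalues] at hmem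
  obtain ⟨i, hi⟩ := hmem
  have := hQ.eigenvalues_pos i
  rw [hi, ← hQ.isHermitian.spectrum_real_eq_range_eigenvalues] at this
  exact this

lemma complexify_care {n : ℕ} {A F Q X : Matrix (Fin n) (Fin n) ℝ}
    (h : Aᵀ * X + X * A - X * F * X + Q = 0) :
    (complexify A)ᴴ * complexify X + complexify X * complexify A -
      complexify X * complexify F * complexify X + complexify Q = 0 := by
  rw [conjTranspose_complexify, ← complexify_mul, ← complexify_mul, ← complexify_mul,
    ← complexify_mul, ← complexify_add, ← complexify_sub, ← complexify_add, h]
  ext i j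
  simp [complexify]

lemma complexify_closedLoop {n : ℕ} (A F X : Matrix (Fin n) (Fin n) ℝ) :
    complexify (closedLoop A F X) = complexify A - complexify F * complexify X := by
  rw [closedLoop, complexify_sub, complexify_mul]

lemma norm_inv_pos {n : ℕ} (hn : 1 ≤ n) {F : Matrix (Fin n) (Fin n) ℝ} (hF : F.PosDef) :
    0 < ‖F⁻¹‖ := by
  have : Nonempty (Fin n) := ⟨⟨0, hn⟩⟩
  refine norm_pos_iff.2 fun h => ?_
  have := mul_nonsing_inv _ ((isUnit_iff_isUnit_det _).1 hF.isUnit)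
  rw [h, mul_zero] at this
  exact zero_ne_one this

/-- The eigenvalues of the closed-loop matrix of a principal subproblem. -/
theorem principal_closedLoop_eigs {n j : ℕ} (hn : 1 ≤ n) {A F Q : Matrix (Fin n) (Fin n) ℝ}
    (hF : F.PosDef) (hQ : Q.PosDef) {e : Fin j → Fin n} (he : Function.Injective e)
    {Y : Matrix (Fin j) (Fin j) ℝ}
    (hY : IsStabilizingSolution (A.submatrix e e) (F.submatrix e e) (Q.submatrix e e) Y)
    {z : ℂ} (hz : z ∈ eigs (closedLoop (A.submatrix e e) (F.submatrix e e) Y)) :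
    z.re ≤ -√(lambdaMin Q / ‖F⁻¹‖) ∧ rLower F Q ≤ ‖z‖ ∧ ‖z‖ ≤ rUpper A F Q := by
  have hstab := hY.stable z hz
  have hsub : ∀ M : Matrix (Fin n) (Fin n) ℝ,
      complexify (M.submatrix e e) = (complexify M).submatrix e e := fun M => rfl
  rw [eigs, complexify_closedLoop] at hz
  obtain ⟨v, hv, hzv⟩ := exists_eigenvector_of_mem_spectrum hz
  have hnorm : ∀ M : Matrix (Fin n) (Fin n) ℝ, ‖complexify (M.submatrix e e)‖ ≤ ‖M‖ := fun M => by
    rw [hsub]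
    exact (norm_submatrix_le he _).trans (norm_complexify_le M)
  have hFc := complexify_posDef hF
  have hinv : ‖(complexify (F.submatrix e e))⁻¹‖ ≤ ‖F⁻¹‖ := by
    rw [hsub]
    refine (norm_inv_submatrix_le he hFc).trans ?_
    rw [complexify_inv hF.isUnit]
    exact norm_complexify_le _
  have hQ₀ : (complexify (Q.submatrix e e) - (lambdaMin Q : ℂ) • 1).PosSemidef := by
    have := (complexify_posSemidef (sub_lambdaMin_posSemidef hQ.isHermitian)).submatrix e
    rw [complexify_sub, complexify_smul, complexify_one, submatrix_sub] at this
    convert this using 2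
    rw [← submatrix_one e he]
    rfl
  obtain ⟨h1, h2⟩ := closedLoop_eigenvalue_bounds (complexify_posDef (hF.submatrix he))
    (complexify_posSemidef hY.posSemidef).isHermitian (complexify_care hY.care) (hnorm A) (hnorm F)
    hinv hQ₀ (hnorm Q) hv hzv
  have hψ := norm_inv_pos hn hF
  have hq := lambdaMin_pos hn hQ
  have h3 : lambdaMin Q / ‖F⁻¹‖ ≤ z.re ^ 2 := by
    rw [div_le_iff₀ hψ]; linarith
  refine ⟨?_, ?_, ?_⟩
  · have := Real.sqrt_le_sqrt h3
    rw [Real.sqrt_sq_eq_abs, abs_of_nonpos hstab] at this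
    linarith
  -- |z| ≥ |Re z| already gives the radius without the factor 3.
  · rw [rLower]
    refine (Real.sqrt_le_sqrt ?_).trans ((Real.sqrt_sq_eq_abs _).le.trans (Complex.abs_re_le_norm z))
    refine le_trans ?_ h3
    gcongr
    linarith
  -- |z|² ≤ ‖A‖²κ(F) + ‖Q‖‖F‖, so the second summand of the outer radius suffices.
  · rw [rUpper]
    refine le_trans (le_trans ?_ (Real.sqrt_le_sqrt
      (x := ‖z‖ ^ 2) (y := 2 * ‖A‖ ^ 2 * cond2 F + ‖Q‖ * ‖F‖) ?_))
      (le_add_of_nonneg_left (by positivity))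
    · rw [Real.sqrt_sq (norm_nonneg _)]
    · have : 0 ≤ ‖A‖ ^ 2 * (‖F‖ * ‖F⁻¹‖) := by positivity
      rw [cond2]
      linarith

end SubproblemBounds

/-! ### From rational functions to shifts: Blaschke products and Zolotarev numbers. -/

section Shifts

open Polynomial
open scoped ComplexConjugate

lemma norm_add_conj_le_norm_sub {d p : ℂ} (hd : d.re < 0) (hp : 0 ≤ p.re) :
    ‖d + conj p‖ ≤ ‖d - p‖ := by
  refine le_of_sq_le_sq ?_ (norm_nonneg _)
  rw [Complex.sq_norm, Complex.sq_norm, Complex.normSq_apply, Complex.normSq_apply]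
  simp only [Complex.add_re, Complex.add_im, Complex.conj_re, Complex.conj_im, Complex.sub_re,
    Complex.sub_im]
  nlinarith

lemma norm_sub_le_norm_add_conj {d p : ℂ} (hd : d.re < 0) (hp : p.re ≤ 0) :
    ‖d - p‖ ≤ ‖d + conj p‖ := by
  refine le_of_sq_le_sq ?_ (norm_nonneg _)
  rw [Complex.sq_norm, Complex.sq_norm, Complex.normSq_apply, Complex.normSq_apply]
  simp only [Complex.add_re, Complex.add_im, Complex.conj_re, Complex.conj_im, Complex.sub_re,
    Complex.sub_im]
  nlinarith

lemma prod_shifts_le_one {ps : List ℂ} (hps : ∀ p ∈ ps, 0 < p.re) {d : ℂ} (hd : d.re < 0) :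
    (ps.map fun p => ‖d + conj p‖ / ‖d - p‖).prod ≤ 1 := by
  calc (ps.map fun p => ‖d + conj p‖ / ‖d - p‖).prod ≤ (ps.map fun _ => (1 : ℝ)).prod :=
        List.prod_map_le_prod_map₀ _ _ (fun p _ => by positivity) fun p hp =>
          div_le_one_of_le₀ (norm_add_conj_le_norm_sub hd (hps p hp).le) (norm_nonneg _)
    _ = 1 := by simp

lemma prod_shifts_nonneg (ps : List ℂ) (d : ℂ) :
    0 ≤ (ps.map fun p => ‖d + conj p‖ / ‖d - p‖).prod :=
  List.prod_nonneg fun x hx => by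
    obtain ⟨p, -, rfl⟩ := List.mem_map.1 hx
    positivity

/-- Points outside the right half plane may be dropped from a product of Blaschke factors. -/
lemma prod_filter_shifts_mul_le (l : Multiset ℂ) {d : ℂ} (hd : d.re < 0) :
    ((l.filter fun p => 0 < p.re).map fun p => ‖d + conj p‖ / ‖d - p‖).prod *
      (l.map fun p => ‖d - p‖).prod ≤ (l.map fun p => ‖d + conj p‖).prod := by
  induction l using Multiset.induction with
  | empty => simp
  | cons p l ih =>
    have h0 : 0 ≤ ((l.filter fun p => 0 < p.re).map fun p => ‖d + conj p‖ / ‖d - p‖).prod *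
        (l.map fun p => ‖d - p‖).prod := by
      refine mul_nonneg (Multiset.prod_nonneg fun x hx => ?_) (Multiset.prod_nonneg fun x hx => ?_)
      all_goals
        obtain ⟨p, -, rfl⟩ := Multiset.mem_map.1 hx
        positivity
    by_cases hp : 0 < p.re
    · have hne : ‖d - p‖ ≠ 0 := by
        rw [norm_ne_zero_iff, sub_ne_zero]
        rintro rfl
        linarith
      rw [Multiset.filter_cons_of_pos (p := fun p : ℂ => 0 < p.re) _ hp, Multiset.map_cons, Multiset.map_cons,
        Multiset.map_cons, Multiset.prod_cons, Multiset.prod_cons, Multiset.prod_cons]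
      calc _ = ‖d + conj p‖ * (((l.filter fun p => 0 < p.re).map
              fun p => ‖d + conj p‖ / ‖d - p‖).prod * (l.map fun p => ‖d - p‖).prod) := by
            field_simp
        _ ≤ _ := mul_le_mul_of_nonneg_left ih (norm_nonneg _)
    · rw [Multiset.filter_cons_of_neg (p := fun p : ℂ => 0 < p.re) _ hp, Multiset.map_cons,
        Multiset.map_cons, Multiset.prod_cons, Multiset.prod_cons]
      calc _ = ‖d - p‖ * (((l.filter fun p => 0 < p.re).map
              fun p => ‖d + conj p‖ / ‖d - p‖).prod * (l.map fun p => ‖d - p‖).prod) := by ring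
        _ ≤ _ := mul_le_mul (norm_sub_le_norm_add_conj hd (not_lt.1 hp)) ih h0 (norm_nonneg _)

lemma norm_eval_eq_prod_roots (f : ℂ[X]) (z : ℂ) :
    ‖f.eval z‖ = ‖f.leadingCoeff‖ * (f.roots.map fun r => ‖z - r‖).prod := by
  have := map_multiset_prod (normHom (α := ℂ)) (f.roots.map fun r => z - r)
  rw [Multiset.map_map] at this
  rw [(IsAlgClosed.splits f).eval_eq_prod_roots, norm_mul]
  exact congrArg _ this

/-- The zeros and poles of a rational function give shifts whose Blaschke product is at most
`|g (d)| / |g (-conj d)|`. -/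
lemma exists_shifts_mul_le {h : ℕ} {g : RatFunc ℂ} (hg : g ∈ ratDeg h) :
    ∃ ps : List ℂ, ps.length ≤ 2 * h ∧ (∀ p ∈ ps, 0 < p.re) ∧ ∀ d : ℂ, d.re < 0 →
      (ps.map fun p => ‖d + conj p‖ / ‖d - p‖).prod *
        (‖g.num.eval (-conj d)‖ * ‖g.denom.eval d‖) ≤
          ‖g.num.eval d‖ * ‖g.denom.eval (-conj d)‖ := by
  -- A zero r gives the shift -r̄, with |d + p̄| = |d - r| and |d - p| = |-d̄ - r|; a pole r gives
  -- the shift r, with the two roles exchanged. Candidates outside the right half plane have factors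
  -- at least 1 and are dropped.
  set l : Multiset ℂ := g.num.roots.map (fun r => -conj r) + g.denom.roots with hl
  refine ⟨(l.filter fun p => 0 < p.re).toList, ?_, fun p hp => ?_, fun d hd => ?_⟩
  · rw [Multiset.length_toList]
    refine (Multiset.card_le_card (Multiset.filter_le _ _)).trans ?_
    rw [hl, Multiset.card_add, Multiset.card_map]
    have h1 := card_roots' g.num
    have h2 := card_roots' g.denom
    have h3 := hg.1
    have h4 := hg.2
    omega
  · exact (Multiset.mem_filter.1 (Multiset.mem_toList.1 hp)).2
  · have key := prod_filter_shifts_mul_le l hd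
    rw [← Multiset.prod_coe, ← Multiset.map_coe, Multiset.coe_toList]
    have e1 : (l.map fun p => ‖d - p‖).prod = (g.num.roots.map fun r => ‖-conj d - r‖).prod *
        (g.denom.roots.map fun r => ‖d - r‖).prod := by
      rw [hl, Multiset.map_add, Multiset.prod_add, Multiset.map_map]
      congr 2
      refine Multiset.map_congr rfl fun r _ => ?_
      rw [Function.comp_apply, ← Complex.norm_conj (-conj d - r), ← norm_neg]
      simp
      ring_nf
    have e2 : (l.map fun p => ‖d + conj p‖).prod = (g.num.roots.map fun r => ‖d - r‖).prod *
        (g.denom.roots.map fun r => ‖-conj d - r‖).prod := by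
      rw [hl, Multiset.map_add, Multiset.prod_add, Multiset.map_map]
      congr 2
      · refine Multiset.map_congr rfl fun r _ => ?_
        simp [sub_eq_add_neg]
      · refine Multiset.map_congr rfl fun r _ => ?_
        rw [← Complex.norm_conj (-conj d - r), ← norm_neg]
        simp
        ring_nf
    rw [e1, e2] at key
    simp only [norm_eval_eq_prod_roots g.num, norm_eval_eq_prod_roots g.denom]
    calc _ = ‖g.num.leadingCoeff‖ * ‖g.denom.leadingCoeff‖ * (((l.filter fun p => 0 < p.re).map
            fun p => ‖d + conj p‖ / ‖d - p‖).prod *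
            ((g.num.roots.map fun r => ‖-conj d - r‖).prod *
              (g.denom.roots.map fun r => ‖d - r‖).prod)) := by ring
      _ ≤ ‖g.num.leadingCoeff‖ * ‖g.denom.leadingCoeff‖ *
          ((g.num.roots.map fun r => ‖d - r‖).prod *
            (g.denom.roots.map fun r => ‖-conj d - r‖).prod) :=
          mul_le_mul_of_nonneg_left key (by positivity)
      _ = _ := by ring

lemma ofReal_le_iSup_div_iInf {b : ℝ} {E : Set ℂ} {g : RatFunc ℂ} {d e : ℂ} (hd : d ∈ E)
    (he : e ∈ -E) (hb : 0 ≤ b) (hden : g.denom.eval d ≠ 0) (hnum : g.num.eval e ≠ 0)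
    (h : b * (‖g.num.eval e‖ * ‖g.denom.eval d‖) ≤ ‖g.num.eval d‖ * ‖g.denom.eval e‖) :
    ENNReal.ofReal b ≤ (⨆ z ∈ E, ratAbs g z) / (⨅ z ∈ -E, ratAbs g z) := by
  rcases hb.eq_or_lt with rfl | hb
  · simp
  have hS : ratAbs g d ≤ ⨆ z ∈ E, ratAbs g z := le_iSup₂_of_le d hd le_rfl
  have hI : (⨅ z ∈ -E, ratAbs g z) ≤ ratAbs g e := iInf₂_le e he
  -- For b > 0 the inequality itself excludes a zero of g at d and a pole at e, so both values are
  -- finite and nonzero and the quotient is not a degenerate one.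
  have hpos : 0 < ‖g.num.eval d‖ * ‖g.denom.eval e‖ :=
    lt_of_lt_of_le (by have := norm_pos_iff.2 hden; have := norm_pos_iff.2 hnum; positivity) h
  have hnd : g.num.eval d ≠ 0 := by
    rintro h0
    simp [h0] at hpos
  have hde : g.denom.eval e ≠ 0 := by
    rintro h0
    simp [h0] at hpos
  have hratio : ∀ z, g.denom.eval z ≠ 0 →
      ratAbs g z = ENNReal.ofReal (‖g.num.eval z‖ / ‖g.denom.eval z‖) := fun z hz => by
    rw [ratAbs, ENNReal.ofReal_div_of_pos (norm_pos_iff.2 hz), ofReal_norm, ofReal_norm]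
  have hS0 : (⨆ z ∈ E, ratAbs g z) ≠ 0 := by
    refine (lt_of_lt_of_le ?_ hS).ne'
    rw [hratio d hden, ENNReal.ofReal_pos]
    exact div_pos (norm_pos_iff.2 hnd) (norm_pos_iff.2 hden)
  have hIt : (⨅ z ∈ -E, ratAbs g z) ≠ ⊤ := by
    refine (lt_of_le_of_lt hI ?_).ne
    rw [hratio e hde]
    exact ENNReal.ofReal_lt_top
  rw [ENNReal.le_div_iff_mul_le (Or.inr hS0) (Or.inl hIt)]
  refine (mul_le_mul_right hI _).trans (le_trans ?_ hS)
  rw [hratio d hden, hratio e hde, ← ENNReal.ofReal_mul hb.le]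
  refine ENNReal.ofReal_le_ofReal ?_
  rw [← mul_div_assoc, div_le_div_iff₀ (norm_pos_iff.2 hde) (norm_pos_iff.2 hden)]
  linarith

/-- Makes the Zolotarev number finite, so that `toReal` loses nothing. -/
lemma zolotarev_le_one (h : ℕ) (E F : Set ℂ) : zolotarev h E F ≤ 1 := by
  have h1 : ∀ z, ratAbs 1 z = 1 := fun z => by simp [ratAbs]
  refine (iInf₂_le (1 : RatFunc ℂ) ⟨⟨by simp, by simp⟩, by simp, by simp⟩).trans ?_
  simp only [h1]
  refine ENNReal.div_le_of_le_mul ?_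
  rw [one_mul]
  exact (iSup₂_le fun _ _ => le_rfl).trans (le_iInf₂ fun _ _ => le_rfl)

/-- A bound in terms of shifts in the right half plane gives a bound by a Zolotarev number. -/
theorem le_mul_toReal_zolotarev {h : ℕ} {E : Set ℂ} (hre : ∀ z ∈ E, z.re < 0)
    (hconj : ∀ z ∈ E, conj z ∈ E) {s K : ℝ} (hK : 0 ≤ K)
    (H : ∀ ps : List ℂ, ps.length ≤ 2 * h → (∀ p ∈ ps, 0 < p.re) → ∀ β : ℝ, 0 ≤ β → β ≤ 1 →
      (∀ d ∈ E, (ps.map fun p => ‖d + conj p‖ / ‖d - p‖).prod ≤ β) → s ≤ K * β) :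
    s ≤ K * (zolotarev h E (-E)).toReal := by
  rcases hK.eq_or_lt with rfl | hK
  · simpa using H [] (by simp) (by simp) 1 zero_le_one le_rfl (by simp)
  rw [← div_le_iff₀' hK, ← ENNReal.ofReal_le_iff_le_toReal
    ((zolotarev_le_one h E (-E)).trans_lt ENNReal.one_lt_top).ne]
  refine le_iInf₂ fun g hg => ?_
  obtain ⟨hdeg, hden, hnum⟩ := hg
  set R := (⨆ z ∈ E, ratAbs g z) / (⨅ z ∈ -E, ratAbs g z) with hR
  by_cases hRt : R = ⊤
  · rw [hRt]; exact le_top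
  obtain ⟨ps, hlen, hps, hprod⟩ := exists_shifts_mul_le hdeg
  -- Capping at 1 is free, since every Blaschke factor is at most 1, and it later allows β² ≤ β.
  have hβ : ∀ d ∈ E, (ps.map fun p => ‖d + conj p‖ / ‖d - p‖).prod ≤ min 1 R.toReal := by
    intro d hd
    have hm : -conj d ∈ -E := by simpa using hconj d hd
    refine le_min (prod_shifts_le_one hps (hre d hd))
      ((ENNReal.ofReal_le_iff_le_toReal hRt).1 ?_)
    exact ofReal_le_iSup_div_iInf hd hm (prod_shifts_nonneg ps d) (hden d hd) (hnum _ hm)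
      (hprod d (hre d hd))
  rw [ENNReal.ofReal_le_iff_le_toReal hRt, div_le_iff₀' hK]
  exact (H ps hlen hps _ (le_min zero_le_one ENNReal.toReal_nonneg) (min_le_left _ _) hβ).trans
    (mul_le_mul_of_nonneg_left (min_le_right _ _) hK.le)

end Shifts

/-! ### Singular value decay of the off-diagonal blocks. -/

section BlockBounds

open Matrix
open scoped ComplexConjugate ComplexOrder

lemma rank_le_qsrank {n : ℕ} {M : Matrix (Fin n) (Fin n) ℝ}
    {B : (p : ℕ) × (q : ℕ) × Matrix (Fin p) (Fin q) ℝ} (hB : B ∈ Off M) :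
    B.2.2.rank ≤ qsrank M := by
  refine le_csSup ⟨n, ?_⟩ ⟨B, hB, rfl⟩
  rintro _ ⟨B', ⟨s, -, hs, rfl | rfl⟩, rfl⟩
  · exact (rank_le_width _).trans hs.le
  · exact (rank_le_width _).trans (Nat.sub_le n s)

lemma submatrix_one_eq_zero {k l n : ℕ} {e : Fin k → Fin n} {f : Fin l → Fin n}
    (h : Function.Injective (Sum.elim e f)) : (1 : Matrix (Fin n) (Fin n) ℂ).submatrix f e = 0 := by
  ext i j
  rw [submatrix_apply, one_apply_ne]
  · rfl
  · intro hij
    have : Sum.elim e f (Sum.inr i) = Sum.elim e f (Sum.inl j) := hij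
    exact Sum.inr_ne_inl (h this)

/-- The singular values of an off-diagonal block of the solution, in terms of shifts. -/
theorem sigma_submatrix_le {n k l : ℕ} {A F Q X : Matrix (Fin n) (Fin n) ℝ}
    (hF : F.PosDef) (hX : X.PosSemidef) (hcare : Aᵀ * X + X * A - X * F * X + Q = 0)
    {e : Fin k → Fin n} {f : Fin l → Fin n} (hef : Function.Bijective (Sum.elim e f))
    {V : Matrix (Fin n) (Fin n) ℂ} {d : Fin n → ℂ} (hV : IsUnit V)
    (hVd : complexify (closedLoop A F X) * V = V * diagonal d) (hd : ∀ i, (d i).re < 0)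
    {ra rf rq : ℕ} (hA₁ : (A.submatrix f e).rank ≤ ra) (hA₂ : (A.submatrix e f).rank ≤ ra)
    (hFr : (F.submatrix f e).rank ≤ rf) (hQr : (Q.submatrix f e).rank ≤ rq)
    {ps : List ℂ} (hps : ∀ p ∈ ps, 0 < p.re) {β : ℝ} (hβ0 : 0 ≤ β)
    (hβ : ∀ i, (ps.map fun p => ‖d i + conj p‖ / ‖d i - p‖).prod ≤ β)
    {r : ℕ} (hr : ps.length * (2 * ra + rf + rq) ≤ r) :
    sigma (X.submatrix f e) (r + 1) ≤ ‖X‖ * (‖V‖ * ‖V⁻¹‖ * β) ^ 2 := by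
  have he : Function.Injective e := fun a b h => Sum.inl_injective (hef.1 (by simpa using h))
  have hf : Function.Injective f := fun a b h => Sum.inr_injective (hef.1 (by simpa using h))
  have h₁ : (inclusionMatrix e)ᴴ * inclusionMatrix e = 1 := by
    rw [conjTranspose_inclusionMatrix_mul, submatrix_one e he]
  have h₂₁ : (inclusionMatrix f)ᴴ * inclusionMatrix e = 0 := by
    rw [conjTranspose_inclusionMatrix_mul, submatrix_one_eq_zero hef.1]
  rw [complexify_closedLoop] at hVd
  obtain ⟨E, hE, hrank⟩ := exists_low_rank_approximation (complexify_posSemidef hX)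
    (complexify_posDef hF) (complexify_care hcare) h₁ h₂₁ (inclusionMatrix_mul_add_mul hef)
    hV hVd hd ps hps hβ0 hβ
  simp only [conjTranspose_inclusionMatrix_mul_mul] at hrank
  have hrk : ∀ (M : Matrix (Fin n) (Fin n) ℝ) {s : ℕ}, (M.submatrix f e).rank ≤ s →
      ((complexify M).submatrix f e).rank ≤ s := fun M s h =>
    (rank_complexify_le (M.submatrix f e)).trans h
  have hAt : ((complexify A)ᴴ.submatrix f e).rank ≤ ra := by
    rw [conjTranspose_complexify]
    -- A block of Aᵀ is the transpose of the opposite block of A; this is why A is counted twice in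
    -- t.
    refine hrk Aᵀ ?_
    rwa [← transpose_submatrix, rank_transpose]
  refine sigma_succ_le_of_rank_le _ (hrank.trans (le_trans (Nat.mul_le_mul_left _ ?_) hr)) ?_
  · have := hrk A hA₁
    have := hrk F hFr
    have := hrk Q hQr
    omega
  · have e1 : complexify (X.submatrix f e) - (complexify X + E).submatrix f e =
        -(E.submatrix f e) := by
      ext i j
      simp [complexify]
    rw [e1, norm_neg, ← conjTranspose_inclusionMatrix_mul_mul]
    refine (norm_conjTranspose_mul_mul_le E (norm_inclusionMatrix_le he)
      (norm_inclusionMatrix_le hf)).trans (hE.trans ?_)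
    gcongr
    exact norm_complexify_le X

theorem sigma_off_le {n : ℕ} {A F Q X : Matrix (Fin n) (Fin n) ℝ}
    (hF : F.PosDef) (hX : X.PosSemidef) (hcare : Aᵀ * X + X * A - X * F * X + Q = 0)
    {V : Matrix (Fin n) (Fin n) ℂ} {d : Fin n → ℂ} (hV : IsUnit V)
    (hVd : complexify (closedLoop A F X) * V = V * diagonal d) (hd : ∀ i, (d i).re < 0)
    {ps : List ℂ} (hps : ∀ p ∈ ps, 0 < p.re) {β : ℝ} (hβ0 : 0 ≤ β)
    (hβ : ∀ i, (ps.map fun p => ‖d i + conj p‖ / ‖d i - p‖).prod ≤ β)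
    {r : ℕ} (hr : ps.length * (2 * qsrank A + qsrank F + qsrank Q) ≤ r)
    {B : (p : ℕ) × (q : ℕ) × Matrix (Fin p) (Fin q) ℝ} (hB : B ∈ Off X) :
    sigma B.2.2 (r + 1) ≤ ‖X‖ * (‖V‖ * ‖V⁻¹‖ * β) ^ 2 := by
  obtain ⟨s, hs1, hs, hB⟩ := hB
  have hlower : ∀ M : Matrix (Fin n) (Fin n) ℝ,
      (M.submatrix (lastIdx (Nat.sub_le n s)) (firstIdx hs.le)).rank ≤ qsrank M := fun M =>
    rank_le_qsrank (B := ⟨n - s, s, M.submatrix (lastIdx (Nat.sub_le n s)) (firstIdx hs.le)⟩)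
      ⟨s, hs1, hs, Or.inl rfl⟩
  have hupper : ∀ M : Matrix (Fin n) (Fin n) ℝ,
      (M.submatrix (firstIdx hs.le) (lastIdx (Nat.sub_le n s))).rank ≤ qsrank M := fun M =>
    rank_le_qsrank (B := ⟨s, n - s, M.submatrix (firstIdx hs.le) (lastIdx (Nat.sub_le n s))⟩)
      ⟨s, hs1, hs, Or.inr rfl⟩
  have hbij := bijective_elim_firstIdx_lastIdx hs.le
  rcases hB with rfl | rfl
  · exact sigma_submatrix_le hF hX hcare hbij hV hVd hd (hlower A) (hupper A) (hlower F)
      (hlower Q) hps hβ0 hβ hr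
  · have hbij' : Function.Bijective
        (Sum.elim (lastIdx (Nat.sub_le n s)) (firstIdx hs.le)) := by
      have := hbij.comp (Equiv.sumComm _ _).bijective
      convert this using 1
      ext x
      rcases x with x | x <;> rfl
    exact sigma_submatrix_le hF hX hcare hbij' hV hVd hd (hupper A) (hlower A) (hupper F)
      (hupper Q) hps hβ0 hβ hr

lemma mem_spectrum_of_diagonalizes {ι : Type*} [Fintype ι] [DecidableEq ι] {C V : Matrix ι ι ℂ}
    {d : ι → ℂ} (hV : IsUnit V) (h : C * V = V * diagonal d) (i : ι) : d i ∈ spectrum ℂ C := by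
  rw [spectrum.mem_iff, isUnit_iff_isUnit_det, isUnit_iff_ne_zero, not_not,
    ← exists_mulVec_eq_zero_iff]
  refine ⟨V *ᵥ Pi.single i 1, fun h0 => ?_, ?_⟩
  · have hVd := (isUnit_iff_isUnit_det _).1 hV
    have h1 := congrArg (fun v => V⁻¹ *ᵥ v) h0
    simp only [mulVec_mulVec, nonsing_inv_mul _ hVd, one_mulVec, mulVec_zero] at h1
    have := congrFun h1 i
    simp at this
  · rw [mulVec_mulVec, sub_mul, h, Algebra.algebraMap_eq_smul_one, smul_mul_assoc, one_mul,
      sub_mulVec, smul_mulVec, ← mulVec_mulVec, diagonal_mulVec_single, mul_one, ← mulVec_smul,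
      ← Pi.single_smul, smul_eq_mul, mul_one, sub_self]

lemma kappaEig_nonneg {n : ℕ} (M : Matrix (Fin n) (Fin n) ℝ) : 0 ≤ kappaEig M :=
  Real.sInf_nonneg (by rintro _ ⟨V, -, rfl⟩; positivity)

/-- A bound by the square of the condition number of every eigenvector matrix is one by the square
of the eigenvector condition number. -/
lemma le_kappaEig_sq_mul {n : ℕ} {M : Matrix (Fin n) (Fin n) ℝ} (hM : IsDiagonalizable M)
    {s β : ℝ} (hβ : 0 ≤ β)
    (h : ∀ V, IsEigenvectorMatrix M V → s ≤ (‖V‖ * ‖V⁻¹‖) ^ 2 * β) :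
    s ≤ kappaEig M ^ 2 * β := by
  obtain ⟨V₀, hV₀⟩ := hM
  rcases hβ.eq_or_lt with rfl | hβ
  · simpa using h V₀ hV₀
  rw [← div_le_iff₀ hβ]
  -- The infimum need not be attained; after a square root the claim is that a lower bound of the
  -- set lies below its infimum.
  suffices √(s / β) ≤ kappaEig M from (Real.sqrt_le_iff.1 this).2
  refine le_csInf ⟨_, V₀, hV₀, rfl⟩ ?_
  rintro _ ⟨V, hV, rfl⟩
  exact Real.sqrt_le_iff.2 ⟨by positivity, (div_le_iff₀ hβ).2 (h V hV)⟩

lemma leading_self {n : ℕ} (M : Matrix (Fin n) (Fin n) ℝ) : leading M le_rfl = M := rfl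

/-- Identifies X with the solution of the leading subproblem of order n, so that diagonalizability
of C⁽ⁿ⁾ is available for A - FX. -/
lemma IsStabilizingSolution.eq {n : ℕ} {A F Q X Y : Matrix (Fin n) (Fin n) ℝ}
    (hF : F.IsHermitian)
    (hX : IsStabilizingSolution A F Q X) (hY : IsStabilizingSolution A F Q Y)
    (hsX : ∀ z ∈ eigs (closedLoop A F X), z.re < 0) (hsY : ∀ z ∈ eigs (closedLoop A F Y), z.re < 0)
    (hd : IsDiagonalizable (closedLoop A F Y)) : X = Y := by
  obtain ⟨V, hV, d, hVd⟩ := hd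
  have hdre : ∀ i, (d i).re < 0 := fun i => hsY _ (mem_spectrum_of_diagonalizes hV hVd i)
  rw [eigs, complexify_closedLoop] at hsX
  rw [complexify_closedLoop] at hVd
  have hFc : (complexify F).IsHermitian := by
    have h : Fᵀ = F := hF
    rw [IsHermitian, conjTranspose_complexify, h]
  have := eq_of_stable_of_diagonalizes (complexify_posSemidef hX.posSemidef).isHermitian hFc
    (complexify_care hX.care) (complexify_care hY.care) hsX hV hVd hdre
  ext i j
  exact Complex.ofReal_injective (congrFun (congrFun this i) j)

lemma eigs_nonempty {n : ℕ} (hn : 1 ≤ n) (M : Matrix (Fin n) (Fin n) ℝ) : (eigs M).Nonempty := by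
  have : Nonempty (Fin n) := ⟨⟨0, hn⟩⟩
  exact spectrum.nonempty_of_isAlgClosed_of_finiteDimensional ℂ _

lemma finite_subproblemEigs {n : ℕ} (A F : Matrix (Fin n) (Fin n) ℝ)
    (Xl Xt : ∀ j : ℕ, Matrix (Fin j) (Fin j) ℝ) : (subproblemEigs A F Xl Xt).Finite :=
  (Set.finite_iUnion fun _ => Matrix.finite_spectrum _).union
    (Set.finite_iUnion fun _ => Matrix.finite_spectrum _)

/-- The constant dominates the square of the eigenvector condition number of the full problem. -/
lemma kappaEig_sq_le_kappaConst {n : ℕ} (hn : 1 ≤ n) {A F X : Matrix (Fin n) (Fin n) ℝ}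
    {Xl Xt : ∀ j : ℕ, Matrix (Fin j) (Fin j) ℝ} (hX : Xl n = X) :
    kappaEig (closedLoop A F X) ^ 2 ≤ kappaConst A F X Xl Xt := by
  rw [kappaConst, sq]
  refine mul_le_mul_of_nonneg_left (le_max_of_le_left ?_) (kappaEig_nonneg _)
  have := le_ciSup (f := fun j : Set.Icc 1 n =>
    kappaEig (closedLoop (leading A j.2.2) (leading F j.2.2) (Xl j)))
    (Set.finite_range _).bddAbove ⟨n, hn, le_rfl⟩
  simpa only [leading_self, hX] using this

lemma lastIdx_injective {j n : ℕ} (hj : j ≤ n) : Function.Injective (lastIdx hj) := by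
  intro a b h
  simp only [lastIdx, Fin.ext_iff] at h
  exact Fin.ext (by omega)

/-- The singular value decay of the off-diagonal blocks for a set containing the spectrum of the
closed-loop matrix. -/
theorem sigma_off_div_norm_le {n : ℕ} {A F Q X : Matrix (Fin n) (Fin n) ℝ} (hF : F.PosDef)
    (hX : IsStabilizingSolution A F Q X) (hdiag : IsDiagonalizable (closedLoop A F X))
    {E : Set ℂ} (hre : ∀ z ∈ E, z.re < 0) (hconj : ∀ z ∈ E, conj z ∈ E)
    (hE : eigs (closedLoop A F X) ⊆ E) {B : (p : ℕ) × (q : ℕ) × Matrix (Fin p) (Fin q) ℝ}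
    (hB : B ∈ Off X) (h : ℕ) :
    sigma B.2.2 (h * (4 * qsrank A + 2 * qsrank F + 2 * qsrank Q) + 1) / ‖X‖ ≤
      kappaEig (closedLoop A F X) ^ 2 * (zolotarev h E (-E)).toReal := by
  refine le_mul_toReal_zolotarev hre hconj (sq_nonneg _) fun ps hlen hps β hβ0 hβ1 hβ => ?_
  refine le_kappaEig_sq_mul hdiag hβ0 fun V hV => ?_
  obtain ⟨hVu, d, hVd⟩ := hV
  have hdE : ∀ i, d i ∈ E := fun i => hE (mem_spectrum_of_diagonalizes hVu hVd i)
  -- Up to two shifts per degree, one for a zero and one for a pole: hence the doubled ranks in t.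
  have hr : ps.length * (2 * qsrank A + qsrank F + qsrank Q) ≤
      h * (4 * qsrank A + 2 * qsrank F + 2 * qsrank Q) := by
    calc _ ≤ 2 * h * (2 * qsrank A + qsrank F + qsrank Q) := Nat.mul_le_mul_right _ hlen
      _ = _ := by ring
  have hσ := sigma_off_le hF hX.posSemidef hX.care hVu hVd (fun i => hre _ (hdE i)) hps hβ0
    (fun i => hβ _ (hdE i)) hr hB
  refine div_le_of_le_mul₀ (norm_nonneg _) (by positivity) ?_
  calc _ ≤ ‖X‖ * (‖V‖ * ‖V⁻¹‖ * β) ^ 2 := hσ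
    _ = (‖V‖ * ‖V⁻¹‖) ^ 2 * (β * β) * ‖X‖ := by ring
    _ ≤ (‖V‖ * ‖V⁻¹‖) ^ 2 * (β * 1) * ‖X‖ := by gcongr
    _ = _ := by ring

end BlockBounds

end Riccati

/-! ### The main theorem. -/

theorem corollary2p6 (n ra rf rq : ℕ) (hn : 1 ≤ n)
    (A F Q X : Matrix (Fin n) (Fin n) ℝ)
    (hA : qsrank A = ra) (hF : qsrank F = rf) (hQ : qsrank Q = rq)
    (hW : numRange A ⊆ {z : ℂ | z.re < 0})
    (hFpos : F.PosDef) (hQpos : Q.PosDef)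
    (hX : IsStabilizingSolution A F Q X)
    (Xl Xt : ∀ j : ℕ, Matrix (Fin j) (Fin j) ℝ)
    (hXl : ∀ j : Set.Icc 1 n,
      IsStabilizingSolution (leading A j.2.2) (leading F j.2.2) (leading Q j.2.2) (Xl j))
    (hXt : ∀ j : Set.Icc 1 n,
      IsStabilizingSolution (trailing A j.2.2) (trailing F j.2.2) (trailing Q j.2.2) (Xt j))
    (hdl : ∀ j : Set.Icc 1 n,
      IsDiagonalizable (closedLoop (leading A j.2.2) (leading F j.2.2) (Xl j)))
    (hdt : ∀ j : Set.Icc 1 n,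
      IsDiagonalizable (closedLoop (trailing A j.2.2) (trailing F j.2.2) (Xt j))) :
    ∃ τ : ℝ, 0 < τ ∧
      IsGreatest (Complex.re '' subproblemEigs A F Xl Xt) (-τ) ∧
      subproblemEigs A F Xl Xt ⊆ annulusPart τ (rLower F Q) (rUpper A F Q) ∧
      (∀ B ∈ Off X, ∀ h : ℕ, 1 ≤ h →
        sigma B.2.2 (h * (4 * ra + 2 * rf + 2 * rq) + 1) / ‖X‖ ≤
          kappaConst A F X Xl Xt *
            (zolotarev h (annulusPart τ (rLower F Q) (rUpper A F Q))
              (-annulusPart τ (rLower F Q) (rUpper A F Q))).toReal) ∧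
      (∀ L : Matrix (Fin n) (Fin n) ℝ, IsCholeskyFactor L F →
        ‖Lᵀ * A * (Lᵀ)⁻¹ - L⁻¹ * Aᵀ * L‖ ^ 2 / 4 < lambdaMin Q / ‖F⁻¹‖ →
          √(lambdaMin Q / ‖F⁻¹‖ - ‖Lᵀ * A * (Lᵀ)⁻¹ - L⁻¹ * Aᵀ * L‖ ^ 2 / 4) ≤ τ ∧
          0 < √(lambdaMin Q / ‖F⁻¹‖ - ‖Lᵀ * A * (Lᵀ)⁻¹ - L⁻¹ * Aᵀ * L‖ ^ 2 / 4)) := by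
  subst hA hF hQ
  obtain ⟨hψ, hq⟩ := And.intro (norm_inv_pos hn hFpos) (lambdaMin_pos hn hQpos)
  have hμ : 0 < √(lambdaMin Q / ‖F⁻¹‖) := Real.sqrt_pos.2 (div_pos hq hψ)
  have heigs : ∀ z ∈ subproblemEigs A F Xl Xt, z.re ≤ -√(lambdaMin Q / ‖F⁻¹‖) ∧
      rLower F Q ≤ ‖z‖ ∧ ‖z‖ ≤ rUpper A F Q := by
    rintro z (hz | hz) <;> obtain ⟨j, hj⟩ := Set.mem_iUnion.1 hz
    · exact principal_closedLoop_eigs hn hFpos hQpos (Fin.castLE_injective j.2.2) (hXl j) hj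
    · exact principal_closedLoop_eigs hn hFpos hQpos (lastIdx_injective j.2.2) (hXt j) hj
  let N : Set.Icc 1 n := ⟨n, hn, le_rfl⟩
  have hXN : IsStabilizingSolution A F Q (Xl n) := hXl N
  have hsub : eigs (closedLoop A F (Xl n)) ⊆ subproblemEigs A F Xl Xt := fun z hz =>
    Or.inl (Set.mem_iUnion.2 ⟨N, hz⟩)
  -- Stabilizing only means Re z ≤ 0; the strict inequality needed for uniqueness comes from the
  -- eigenvalue bounds.
  have hXeq : X = Xl n := hX.eq hFpos.isHermitian hXN
    (fun z hz => (principal_closedLoop_eigs hn hFpos hQpos Function.injective_id hX hz).1.trans_lt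
      (neg_neg_of_pos hμ))
    (fun z hz => (heigs z (hsub hz)).1.trans_lt (neg_neg_of_pos hμ)) (hdl N)
  obtain ⟨w, hw, hwmax⟩ := Set.exists_max_image _ Complex.re (finite_subproblemEigs A F Xl Xt)
    ((eigs_nonempty hn _).mono hsub)
  have hτ : √(lambdaMin Q / ‖F⁻¹‖) ≤ -w.re := le_neg_of_le_neg (heigs w hw).1
  have hτ0 : 0 < -w.re := hμ.trans_le hτ
  have hE : subproblemEigs A F Xl Xt ⊆ annulusPart (-w.re) (rLower F Q) (rUpper A F Q) :=
    fun z hz => ⟨by rw [neg_neg]; exact hwmax z hz, (heigs z hz).2⟩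
  refine ⟨-w.re, hτ0, ?_, hE, fun B hB h _ => ?_, fun L _ hlt => ⟨?_, ?_⟩⟩
  · rw [neg_neg]
    exact ⟨⟨w, hw, rfl⟩, by rintro _ ⟨z, hz, rfl⟩; exact hwmax z hz⟩
  · refine (sigma_off_div_norm_le hFpos hX (hXeq ▸ hdl N) (fun z hz => ?_) (fun z hz => ?_)
      (hXeq ▸ hsub.trans hE) hB h).trans
      (mul_le_mul_of_nonneg_right (kappaEig_sq_le_kappaConst hn hXeq.symm) ENNReal.toReal_nonneg)
    · exact hz.1.trans_lt (neg_neg_of_pos hτ0)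
    · simpa [annulusPart] using hz
  -- `hτ` is the bound without the subtracted square, hence at least as strong.
  · refine (Real.sqrt_le_sqrt ?_).trans hτ
    have : 0 ≤ ‖Lᵀ * A * (Lᵀ)⁻¹ - L⁻¹ * Aᵀ * L‖ ^ 2 / 4 := by positivity
    linarith
  · exact Real.sqrt_pos.2 (sub_pos.2 hlt)
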